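/- **Setting.** Let $V$ be a countable set and $p:V\times V\to[0,1]$ a transition kernel, i.e. $\sum_y p(x,y)=1$ for all $x$. Let $\alpha:V\to(0,\infty)$ be a localization function for $p$, i.e. $\sum_x\alpha(x)<\infty$ and $\sup_x\sum_y p(x,y)\alpha(y)/\alpha(x)<\infty$, and let $C>0$ be such that $\sum_y p(x,y)\alpha(y)\le C\,\alpha(x)$ for all $x\in V$. For $\zeta\in\mathbb R^V$ put $\|\zeta\|=\sum_x\alpha(x)|\zeta(x)|$, and let $$E_0=\Big\{\eta\in\mathbb N_0^V:\sum_x\eta(x)<\infty\Big\},\qquad E_\alpha=\{\eta\in\mathbb N_0^V:\|\eta\|<\infty\}.$$ Let $F^+,F^-:\mathbb N_0\to\mathbb R$ satisfy $F^+(0)=F^-(0)=0$, $0\le F^+\le F^-$, and $F^+-F^-$ is decreasing (in the weak sense). The marks are $(x,+)$, $(x,-)$ and $(x,y)$ for $x,y\in V$. Their transitions are $\Gamma^{(x,+)}\eta=\eta+\delta_x$, $\Gamma^{(x,-)}\eta=\eta-\delta_x$, $\Gamma^{(x,y)}\eta=\eta-\delta_x+\delta_y$, with rates $R^{(x,+)}(\eta)=F^+(\eta(x))$,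 $R^{(x,-)}(\eta)=F^-(\eta(x))$, $R^{(x,y)}(\eta)=p(x,y)\eta(x)$. On a probability space $(\Omega,\mathcal F,\mathbb P)$ let $(\mathcal X^{\mathfrak m})$, indexed by the marks $\mathfrak m$, be independent Poisson point processes on $(0,\infty)^2$ with Lebesgue intensity. For $\eta\in E_0$ and $t\ge0$ let $\Phi_t(\eta)$ be the following random configuration. Start from $s^0=0$, $\eta^0=\eta$. For $k\ge1$ let $s^k$ be the infimum of the times $r\in(s^{k-1},t]$ for which there are a mark $\mathfrak m$ and $u>0$ with $(r,u)\in\mathcal X^{\mathfrak m}$ and $u<R^{\mathfrak m}(\eta^{k-1})$ (with $\inf\varnothing=\infty$). If $s^k<\infty$, put $\eta^k=\Gamma^{\mathfrak m^k}(\eta^{k-1})$, where $\mathfrak m^k$ is the (almost surely unique) mark for which this happens at time $s^k$. Almost surely there is a $k_\star$ with $s^{k_\star}<\infty=s^{k_\star+1}$; put $\Phi_t(\eta)=\eta^{k_\star}$. **Lemma (extension to $E_\alpha$).** Let $\eta\in E_\alpha$. There are a set $\Omega_\eta\subset\Omega$ of full measure and random configurations $\Phi_t(\eta)$, $t\ge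 0$, with $\Phi_t(\eta)(\omega)\in E_\alpha$ for all $\omega\in\Omega_\eta$ and all $t\ge0$, such that for every $\omega\in\Omega_\eta$, every (coordinatewise) increasing sequence $(\eta_n)$ in $E_0$ with $\|\eta_n-\eta\|\to0$, and every $t\ge0$, $$\|\Phi_t(\eta_n)(\omega)-\Phi_t(\eta)(\omega)\|\longrightarrow0\quad(n\to\infty).$$ In particular the limit does not depend on the choice of the sequence $(\eta_n)$. Moreover, for all $T\ge0$, $A>0$ and $t\ge0$, $$\mathbb P\Big(\sup_{0\le t\le T}\|\Phi_t(\eta)\|>A\Big)\le\frac{e^{(C+1)T}\,\|\eta\|}{A}\qquad\text{and}\qquad\mathbb E\big[\|\Phi_t(\eta)\|\big]<\infty.$$ -/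

import Mathlib

open MeasureTheory ProbabilityTheory Filter Topology
open scoped ENNReal NNReal

namespace ReactionDiffusion

/-! ### Poisson point processes -/

/-- `X` is a Poisson point process on `E` with (diffuse) intensity `ν`, on the probability space
`(Ω, μ)`: counts of measurable sets are random variables, the count of a set of finite intensity
is Poisson distributed, and counts of pairwise disjoint sets are independent. The realization
`X ω` is a set of points, so that `(X ω ∩ B).encard` is the number of points in `B`. -/
structure IsPoissonPointProcess {Ω E : Type*} [MeasurableSpace Ω] [MeasurableSpace E]
    (X : Ω → Set E) (ν : Measure E) (μ : Measure Ω) : Prop where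
  measurable_count : ∀ B : Set E, MeasurableSet B → Measurable fun ω => (X ω ∩ B).encard
  law_count : ∀ B : Set E, MeasurableSet B → ν B ≠ ∞ →
    μ.map (fun ω => (X ω ∩ B).encard)
      = (poissonMeasure (ν B).toNNReal).map (fun n : ℕ => (n : ℕ∞))
  indep_count : ∀ (n : ℕ) (B : Fin n → Set E), (∀ i, MeasurableSet (B i)) →
    Pairwise (fun i j => Disjoint (B i) (B j)) →
    iIndepFun (fun i ω => (X ω ∩ B i).encard) μ

/-- The σ-algebra on `Ω` generated by all the counts of the point process `X`. -/
@[reducible] noncomputable def countSigma {Ω E : Type*} [MeasurableSpace E] (X : Ω → Set E) : MeasurableSpace Ω :=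
  ⨆ B : {B : Set E // MeasurableSet B},
    MeasurableSpace.comap (fun ω => (X ω ∩ B.1).encard) ⊤

/-! ### Kernels, localization functions, reaction functions -/

/-- `p` is a transition kernel on `V`. -/
structure IsTransitionKernel {V : Type*} (p : V → V → ℝ) : Prop where
  nonneg : ∀ x y, 0 ≤ p x y
  hasSum_one : ∀ x, HasSum (p x) 1

/-- `α` is a localization function for `p`. -/
structure IsLocalization {V : Type*} (p : V → V → ℝ) (α : V → ℝ) : Prop where
  pos : ∀ x, 0 < α x
  summable : Summable α
  bddAbove : BddAbove (Set.range fun x => ∑' y, p x y * (α y / α x))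

/-- The assumptions on the birth and death rates `Fp = F⁺` and `Fm = F⁻`. -/
structure IsReactionPair (Fp Fm : ℕ → ℝ) : Prop where
  birth_zero : Fp 0 = 0
  death_zero : Fm 0 = 0
  birth_nonneg : ∀ n, 0 ≤ Fp n
  birth_le_death : ∀ n, Fp n ≤ Fm n
  antitone_sub : Antitone fun n => Fp n - Fm n

/-! ### Configurations -/

/-- The weighted norm `∑ x, α x * |ζ x|`, as an extended nonnegative real number. -/
noncomputable def alphaNorm {V : Type*} (α : V → ℝ) (ζ : V → ℝ) : ℝ≥0∞ :=
  ∑' x, ENNReal.ofReal (α x * |ζ x|)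

/-- A particle configuration, viewed as a real-valued function. -/
def toRealConf {V : Type*} (η : V → ℕ) : V → ℝ := fun x => (η x : ℝ)

/-- The finite configurations. -/
def finiteConf (V : Type*) : Set (V → ℕ) := {η | Summable (toRealConf η)}

/-- The `α`-summable configurations. -/
def alphaConf {V : Type*} (α : V → ℝ) : Set (V → ℕ) := {η | alphaNorm α (toRealConf η) < ∞}

/-! ### Marks, transitions and rates -/

/-- The birth marks `(x,+)`, the death marks `(x,-)` and the jump marks `(x,y)`. -/
inductive Mark (V : Type*) where
  | birth (x : V) : Mark V
  | death (x : V) : Mark V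
  | jump (x y : V) : Mark V

open Classical in
/-- The configuration with a single particle, at `x`. -/
noncomputable def single {V : Type*} (x : V) : V → ℕ := fun z => if z = x then 1 else 0

/-- The transition operators. The subtractions are only ever used at sites that hold a particle,
because the rates of the marks `(x,-)` and `(x,y)` vanish when `η x = 0`. -/
noncomputable def transition {V : Type*} : Mark V → (V → ℕ) → (V → ℕ)
  | .birth x, η => η + single x
  | .death x, η => η - single x
  | .jump x y, η => η - single x + single y

/-- The transition rates. -/
def rate {V : Type*} (p : V → V → ℝ) (Fp Fm : ℕ → ℝ) : Mark V → (V → ℕ) → ℝ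
  | .birth x, η => Fp (η x)
  | .death x, η => Fm (η x)
  | .jump x y, η => p x y * (η x : ℝ)

/-! ### The flow on finite configurations -/

section Flow

variable {V : Type*} (p : V → V → ℝ) (Fp Fm : ℕ → ℝ) (X : Mark V → Set (ℝ × ℝ))

/-- The marks that are active at time `r` when the configuration is `η`, for the realization `X`
of the point processes. -/
def activeMarks (r : ℝ) (η : V → ℕ) : Set (Mark V) :=
  {m | ∃ u : ℝ, 0 < u ∧ (r, u) ∈ X m ∧ u < rate p Fp Fm m η}

/-- The first time in `(s, t]` at which some mark is active for `η`; it is `⊤` if there is none. -/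
noncomputable def nextTime (t : ℝ) (s : EReal) (η : V → ℕ) : EReal :=
  sInf ((fun r : ℝ => (r : EReal)) ''
    {r : ℝ | s < (r : EReal) ∧ r ≤ t ∧ (activeMarks p Fp Fm X r η).Nonempty})

open Classical in
/-- One step of the recursion: from `(s^{k-1}, η^{k-1})` to `(s^k, η^k)`. The configuration is
left alone if `s^k = ⊤`. The active mark at time `s^k` is almost surely unique. -/
noncomputable def flowStep (t : ℝ) (q : EReal × (V → ℕ)) : EReal × (V → ℕ) :=
  (nextTime p Fp Fm X t q.1 q.2,
    if h : nextTime p Fp Fm X t q.1 q.2 ≠ ⊤ ∧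
        (activeMarks p Fp Fm X (nextTime p Fp Fm X t q.1 q.2).toReal q.2).Nonempty then
      transition h.2.some q.2
    else q.2)

/-- The transition times and configurations `(s^k, η^k)`, with `s^0 = s` and `η^0 = η`. -/
noncomputable def flowSeq (s t : ℝ) (η : V → ℕ) (k : ℕ) : EReal × (V → ℕ) :=
  (flowStep p Fp Fm X t)^[k] ((s : EReal), η)

open Classical in
/-- The flow over `[s, t]` started from `η`: the configuration `η^k` for the `k` such that
`s^k < ⊤` and `s^{k+1} = ⊤`. (For finite `η` such a `k` exists almost surely; the value `η` in the
other case is a convention.) -/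
noncomputable def flow (s t : ℝ) (η : V → ℕ) : V → ℕ :=
  if h : ∃ k, (flowSeq p Fp Fm X s t η k).1 < ⊤ ∧ (flowSeq p Fp Fm X s t η (k + 1)).1 = ⊤ then
    (flowSeq p Fp Fm X s t η (Nat.find h)).2
  else η

end Flow

end ReactionDiffusion

/-! The extension rests on two properties of the flow from finite configurations: it is monotone in
the initial configuration, and its weighted mass obeys bounds that are uniform over finite
configurations below `η`. Given both, the flows from the truncations of `η` increase to a limit
(`limitFlow`), and the bounds pass to the limit by monotone convergence.

Monotonicity (`Evolves.mono`) is pathwise. A mark active for both of two ordered configurations acts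
by a monotone map. A birth or death active for only one of them has different rates in the two,
hence different occupation numbers at its site, so a change by one particle there cannot break the
order. Jump rates increase with the occupation number. No monotonicity of `Fp` or `Fm` alone is
needed, but distinct marks must not fire at the same time (`ae_mark_eq_of_mem`).

The mass bounds come from the drift inequality `tsum_rate_mul_weight_le`: births are dominated by
deaths, and a jump moves mass according to `p`, so weighted mass grows at rate at most `c` when `p w
≤ c w`. To turn this into expectations without a generator or stochastic calculus, time is cut into
slices of length `h`. The discretized chain makes a transition in a slice only if exactly one point
is relevant there, and otherwise does nothing. As a Poisson variable satisfies P(N = 1) = l P(N =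
0), the chain has expected growth factor at most `1 + h c` per slice, with no error term. Stopping
the chain when it exceeds `A` and applying Markov's inequality gives the maximal inequality.

Chain and flow agree unless some slice is `Bad`. While the total number of particles is at most `K`,
a slice is bad with probability O(h²), so over `[0, T]` the total is O(h); the maximal inequality
with weight `1` controls the event that `K` is exceeded. Hence `tendsto_measure_badEvent`, which
yields non-explosion, measurability and the mass bounds for the flow.

Finally, an increasing sequence of finite configurations converging to `η` and the truncations of
`η` dominate each other, so they produce the same limit (`Regular.tendsto_flow`). All exceptional
sets can be taken independent of the sequence because there are only countably many finite
configurations. -/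

namespace ReactionDiffusion

/-! ### Pathwise dynamics: evolutions, their agreement with the flow, and attractiveness. -/

section Deterministic

variable {V : Type*}

/-- `Evolves p Fp Fm X s η t ζ n`: for the realization `X`, the configuration `η` at time `s`
evolves into the configuration `ζ` at time `t` through exactly `n` transitions, and at each of the
transition times there is exactly one active mark. -/
inductive Evolves (p : V → V → ℝ) (Fp Fm : ℕ → ℝ) (X : Mark V → Set (ℝ × ℝ)) :
    ℝ → (V → ℕ) → ℝ → (V → ℕ) → ℕ → Prop
  | rest {s t : ℝ} {η : V → ℕ} (hst : s ≤ t)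
      (hq : ∀ r, s < r → r ≤ t → activeMarks p Fp Fm X r η = ∅) :
      Evolves p Fp Fm X s η t η 0
  | jump {s r t : ℝ} {η ζ : V → ℕ} {n : ℕ} {m : Mark V} (hsr : s < r) (hrt : r ≤ t)
      (hq : ∀ r', s < r' → r' < r → activeMarks p Fp Fm X r' η = ∅)
      (hm : activeMarks p Fp Fm X r η = {m})
      (hn : Evolves p Fp Fm X r (transition m η) t ζ n) :
      Evolves p Fp Fm X s η t ζ (n + 1)

variable {p : V → V → ℝ} {Fp Fm : ℕ → ℝ} {X : Mark V → Set (ℝ × ℝ)}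

lemma Evolves.le {s t : ℝ} {η ζ : V → ℕ} {n : ℕ} (h : Evolves p Fp Fm X s η t ζ n) : s ≤ t := by
  cases h with
  | rest hst hq => exact hst
  | jump hsr hrt hq hm hn => exact (hsr.trans_le hrt).le

lemma nextTime_eq_top {s t : ℝ} {η : V → ℕ}
    (hq : ∀ r, s < r → r ≤ t → activeMarks p Fp Fm X r η = ∅) :
    nextTime p Fp Fm X t s η = ⊤ := by
  have : {r : ℝ | (s : EReal) < (r : EReal) ∧ r ≤ t ∧
      (activeMarks p Fp Fm X r η).Nonempty} = ∅ := by
    ext r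
    simp only [Set.mem_ofPred_eq, Set.mem_empty_iff_false, iff_false]
    rintro ⟨h1, h2, h3⟩
    rw [hq r (by exact_mod_cast h1) h2] at h3
    exact Set.not_nonempty_empty h3
  rw [nextTime, this, Set.image_empty, sInf_empty]

lemma nextTime_eq_coe {s r t : ℝ} {η : V → ℕ} (hsr : s < r) (hrt : r ≤ t)
    (hq : ∀ r', s < r' → r' < r → activeMarks p Fp Fm X r' η = ∅)
    (hm : (activeMarks p Fp Fm X r η).Nonempty) :
    nextTime p Fp Fm X t s η = r := by
  refine IsLeast.csInf_eq ⟨⟨r, ⟨by exact_mod_cast hsr, hrt, hm⟩, rfl⟩, ?_⟩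
  rintro _ ⟨r', ⟨h1, h2, h3⟩, rfl⟩
  by_contra hlt
  have hlt : r' < r := by simpa using hlt
  rw [hq r' (by exact_mod_cast h1) hlt] at h3
  exact Set.not_nonempty_empty h3

/-- Peeling the first step off the iteration leaves the same recursion started at the first
transition. The choice of an active mark in `flowStep` is harmless here because there is only one.
-/
lemma flowSeq_succ_of_active {s r t : ℝ} {η : V → ℕ} {m : Mark V} (hsr : s < r) (hrt : r ≤ t)
    (hq : ∀ r', s < r' → r' < r → activeMarks p Fp Fm X r' η = ∅)
    (hm : activeMarks p Fp Fm X r η = {m}) (k : ℕ) :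
    flowSeq p Fp Fm X s t η (k + 1) = flowSeq p Fp Fm X r t (transition m η) k := by
  have hne : (activeMarks p Fp Fm X r η).Nonempty := hm ▸ Set.singleton_nonempty m
  have hnext := nextTime_eq_coe hsr hrt hq hne
  have hcond : nextTime p Fp Fm X t s η ≠ ⊤ ∧
      (activeMarks p Fp Fm X (nextTime p Fp Fm X t s η).toReal η).Nonempty := by
    rw [hnext, EReal.toReal_coe]
    exact ⟨EReal.coe_ne_top r, hne⟩
  have hsome : hcond.2.some = m := by
    have h := hcond.2.some_mem
    have h2 : activeMarks p Fp Fm X (nextTime p Fp Fm X t s η).toReal η = {m} := by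
      rw [hnext, EReal.toReal_coe, hm]
    simpa only [h2, Set.mem_singleton_iff] using (h2 ▸ h : hcond.2.some ∈ ({m} : Set (Mark V)))
  have hstep : flowStep p Fp Fm X t ((s : EReal), η) = ((r : EReal), transition m η) := by
    simp only [flowStep]
    rw [dif_pos hcond, hsome, hnext]
  rw [flowSeq, Function.iterate_succ_apply, hstep, flowSeq]

lemma flowSeq_zero (s t : ℝ) (η : V → ℕ) : flowSeq p Fp Fm X s t η 0 = ((s : EReal), η) := rfl

lemma flowSeq_one (s t : ℝ) (η : V → ℕ) :
    (flowSeq p Fp Fm X s t η 1).1 = nextTime p Fp Fm X t s η := rfl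

lemma Evolves.exists_flowSeq {s t : ℝ} {η ζ : V → ℕ} {n : ℕ}
    (h : Evolves p Fp Fm X s η t ζ n) :
    ∃ k, (flowSeq p Fp Fm X s t η k).1 < ⊤ ∧ (flowSeq p Fp Fm X s t η (k + 1)).1 = ⊤ := by
  induction h with
  | rest hst hq =>
    exact ⟨0, by simp [flowSeq_zero], by rw [flowSeq_one, nextTime_eq_top hq]⟩
  | jump hsr hrt hq hm hn ih =>
    obtain ⟨k, hk⟩ := ih
    refine ⟨k + 1, ?_⟩
    rw [flowSeq_succ_of_active hsr hrt hq hm, flowSeq_succ_of_active hsr hrt hq hm]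
    exact hk

/-- The flow follows every evolution. -/
lemma Evolves.flow_eq {s t : ℝ} {η ζ : V → ℕ} {n : ℕ} (h : Evolves p Fp Fm X s η t ζ n) :
    flow p Fp Fm X s t η = ζ := by
  classical
  induction h with
  | @rest s t η hst hq =>
    have hex := (Evolves.rest hst hq).exists_flowSeq
    rw [flow, dif_pos hex]
    have : Nat.find hex = 0 := by
      rw [Nat.find_eq_zero]
      exact ⟨by simp [flowSeq_zero], by rw [flowSeq_one, nextTime_eq_top hq]⟩
    rw [this, flowSeq_zero]
  | @jump s r t η ζ n m hsr hrt hq hm hn ih =>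
    have hex := (Evolves.jump hsr hrt hq hm hn).exists_flowSeq
    have hex' := hn.exists_flowSeq
    have hsucc := flowSeq_succ_of_active (t := t) hsr hrt hq hm
    rw [flow, dif_pos hex'] at ih
    rw [flow, dif_pos hex]
    have hex2 : ∃ k, (flowSeq p Fp Fm X s t η (k + 1)).1 < ⊤ ∧
        (flowSeq p Fp Fm X s t η (k + 1 + 1)).1 = ⊤ := by
      simpa only [hsucc] using hex'
    -- Index `0` does not qualify, since the next transition time is `r`, which is finite; so the
    -- search shifts by one.
    have hfind : Nat.find hex = Nat.find hex2 + 1 := by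
      refine Nat.find_comp_succ hex hex2 ?_
      rintro ⟨-, h1⟩
      rw [flowSeq_one, nextTime_eq_coe hsr hrt hq (hm ▸ Set.singleton_nonempty m)] at h1
      exact EReal.coe_ne_top r h1
    have hfind2 : Nat.find hex2 = Nat.find hex' := by
      congr 1
      funext k
      rw [hsucc, hsucc]
    rw [hfind, hsucc, hfind2]
    convert ih

/-- A quiet period can be put in front of an evolution. -/
lemma Evolves.prepend {s r t : ℝ} {η ζ : V → ℕ} {n : ℕ} (hsr : s ≤ r)
    (hq : ∀ r', s < r' → r' ≤ r → activeMarks p Fp Fm X r' η = ∅)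
    (h : Evolves p Fp Fm X r η t ζ n) : Evolves p Fp Fm X s η t ζ n := by
  cases h with
  | rest hst hq' =>
    refine .rest (hsr.trans hst) fun u h1 h2 => ?_
    rcases le_or_gt u r with h | h
    exacts [hq u h1 h, hq' u h h2]
  | jump hsr' hrt hq' hm hn =>
    refine .jump (hsr.trans_lt hsr') hrt (fun u h1 h2 => ?_) hm hn
    rcases le_or_gt u r with h | h
    exacts [hq u h1 h, hq' u h h2]

lemma Evolves.trans {s r t : ℝ} {η ξ ζ : V → ℕ} {n k : ℕ} (h : Evolves p Fp Fm X s η r ξ n)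
    (h' : Evolves p Fp Fm X r ξ t ζ k) : Evolves p Fp Fm X s η t ζ (n + k) := by
  induction h with
  | rest hst hq => simpa using h'.prepend hst hq
  | @jump s u r η ξ n m hsr hrt hq hm hn ih =>
    rw [show n + 1 + k = (n + k) + 1 by ring]
    exact .jump hsr (hrt.trans h'.le) hq hm (ih h')

lemma single_apply_self (x : V) : single x x = 1 := by simp [single]

lemma single_apply_of_ne {x z : V} (h : z ≠ x) : single x z = 0 := by simp [single, h]

/-- Truncated subtraction keeps this true at empty sites, for every mark and without any condition
on its rate. -/
lemma transition_mono (m : Mark V) : Monotone (transition m) := by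
  intro η ζ h z
  have : η z ≤ ζ z := h z
  cases m <;> simp only [transition, Pi.add_apply, Pi.sub_apply] <;> omega

/-- A mark that is active for the smaller of two configurations only respects their order. -/
lemma transition_le_of_notMem (hp : ∀ x y, 0 ≤ p x y) {r : ℝ} {m : Mark V} {η ζ : V → ℕ}
    (hle : η ≤ ζ) (hη : m ∈ activeMarks p Fp Fm X r η) (hζ : m ∉ activeMarks p Fp Fm X r ζ) :
    transition m η ≤ ζ := by
  obtain ⟨u, hu, hmem, hlt⟩ := hη
  have hnot : ¬ u < rate p Fp Fm m ζ := fun h => hζ ⟨u, hu, hmem, h⟩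
  intro z
  have hz : η z ≤ ζ z := hle z
  cases m with
  | birth x =>
    rcases eq_or_ne z x with rfl | hzx
    -- Equal occupation numbers would give equal rates, so the mark would be active for both; hence
    -- there is room for one more particle.
    · have : η z ≠ ζ z := fun h => hnot (by simpa only [rate, h] using hlt)
      simp only [transition, Pi.add_apply, single_apply_self]
      omega
    · simpa [transition, single_apply_of_ne hzx] using hz
  | death x =>
    simp only [transition, Pi.sub_apply]
    omega
  | jump x y =>
    -- This case is void: jump rates increase with the configuration.
    refine absurd (hlt.trans_le ?_) hnot
    simp only [rate]
    exact mul_le_mul_of_nonneg_left (by exact_mod_cast hle x) (hp x y)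

/-- A mark that is active for the larger of two configurations only respects their order. -/
lemma le_transition_of_notMem {r : ℝ} {m : Mark V} {η ζ : V → ℕ}
    (hle : η ≤ ζ) (hη : m ∉ activeMarks p Fp Fm X r η) (hζ : m ∈ activeMarks p Fp Fm X r ζ) :
    η ≤ transition m ζ := by
  obtain ⟨u, hu, hmem, hlt⟩ := hζ
  have hnot : ¬ u < rate p Fp Fm m η := fun h => hη ⟨u, hu, hmem, h⟩
  intro z
  have hz : η z ≤ ζ z := hle z
  cases m with
  | birth x =>
    simp only [transition, Pi.add_apply]
    omega
  | death x =>
    rcases eq_or_ne z x with rfl | hzx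
    · have : η z ≠ ζ z := fun h => hnot (by simpa only [rate, h] using hlt)
      simp only [transition, Pi.sub_apply, single_apply_self]
      omega
    · simpa [transition, single_apply_of_ne hzx] using hz
  | jump x y =>
    rcases eq_or_ne z x with rfl | hzx
    · have : η z ≠ ζ z := fun h => hnot (by simpa only [rate, h] using hlt)
      simp only [transition, Pi.sub_apply, Pi.add_apply, single_apply_self]
      omega
    · simp only [transition, Pi.sub_apply, Pi.add_apply, single_apply_of_ne hzx]
      omega

lemma eq_of_mem_activeMarks
    (hX : ∀ m m' : Mark V, ∀ r u u' : ℝ, 0 < r → 0 < u → 0 < u' → (r, u) ∈ X m → (r, u') ∈ X m' →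
      m = m')
    {r : ℝ} (hr : 0 < r) {m m' : Mark V} {η ζ : V → ℕ} (h : m ∈ activeMarks p Fp Fm X r η)
    (h' : m' ∈ activeMarks p Fp Fm X r ζ) : m = m' := by
  obtain ⟨u, hu, hmem, -⟩ := h
  obtain ⟨u', hu', hmem', -⟩ := h'
  exact hX m m' r u u' hr hu hu' hmem hmem'

/-- Attractiveness: evolutions for the same realization preserve the order of configurations. -/
lemma Evolves.mono (hp : ∀ x y, 0 ≤ p x y)
    (hX : ∀ m m' : Mark V, ∀ r u u' : ℝ, 0 < r → 0 < u → 0 < u' → (r, u) ∈ X m → (r, u') ∈ X m' →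
      m = m') (N : ℕ) :
    ∀ {s t : ℝ} {η ζ η' ζ' : V → ℕ} {n k : ℕ}, n + k ≤ N → 0 ≤ s → η ≤ ζ →
      Evolves p Fp Fm X s η t η' n → Evolves p Fp Fm X s ζ t ζ' k → η' ≤ ζ' := by
  induction N with
  | zero =>
    intro s t η ζ η' ζ' n k hN hs hle h1 h2
    cases h1 with
    | rest hst hq =>
      cases h2 with
      | rest hst' hq' => exact hle
      | jump => omega
    | jump => omega
  | succ N ih =>
    intro s t η ζ η' ζ' n k hN hs hle h1 h2
    cases h1 with
    | rest hst hq =>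
      cases h2 with
      | rest hst' hq' => exact hle
      | @jump _ r _ _ _ k m hsr hrt hq' hm hn =>
        refine ih (by omega) (hs.trans hsr.le) ?_
          (.rest hrt fun u h1 h2 => hq u (hsr.trans h1) h2) hn
        refine le_transition_of_notMem hle ?_ (hm ▸ Set.mem_singleton m)
        rw [hq r hsr hrt]
        exact Set.notMem_empty m
    | @jump _ r _ _ _ n m hsr hrt hq hm hn =>
      have hmη : m ∈ activeMarks p Fp Fm X r η := hm ▸ Set.mem_singleton m
      cases h2 with
      | rest hst' hq' =>
        refine ih (by omega) (hs.trans hsr.le) ?_ hn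
          (.rest hrt fun u h1 h2 => hq' u (hsr.trans h1) h2)
        refine transition_le_of_notMem hp hle hmη ?_
        rw [hq' r hsr hrt]
        exact Set.notMem_empty m
      | @jump _ r' _ _ _ k m' hsr' hrt' hq' hm' hn' =>
        have hmζ : m' ∈ activeMarks p Fp Fm X r' ζ := hm' ▸ Set.mem_singleton m'
        -- The earlier of the two transitions is removed, the other evolution being quiet up to
        -- then; simultaneous transitions carry the same mark and are removed together.
        rcases lt_trichotomy r r' with hlt | rfl | hlt
        · refine ih (by omega) (hs.trans hsr.le) ?_ hn
            (.jump hlt hrt' (fun u h1 h2 => hq' u (hsr.trans h1) h2) hm' hn')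
          refine transition_le_of_notMem hp hle hmη ?_
          rw [hq' r hsr hlt]
          exact Set.notMem_empty m
        · obtain rfl := eq_of_mem_activeMarks hX (hs.trans_lt hsr) hmη hmζ
          exact ih (by omega) (hs.trans hsr.le) (transition_mono m hle) hn hn'
        · refine ih (by omega) (hs.trans hsr'.le) ?_
            (.jump hlt hrt (fun u h1 h2 => hq u (hsr'.trans h1) h2) hm hn) hn'
          refine le_transition_of_notMem hle ?_ hmζ
          rw [hq r' hsr' hlt]
          exact Set.notMem_empty m'

end Deterministic

end ReactionDiffusion

namespace ReactionDiffusion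

/-! ### Poisson counts in time slices and their independence. -/

section PoissonCounts

lemma poissonMeasure_compl_zero_le (l : ℝ≥0) : poissonMeasure l {0}ᶜ ≤ l := by
  rw [prob_compl_eq_one_sub (measurableSet_singleton 0), poissonMeasure_singleton,
    tsub_le_iff_right, ← ENNReal.ofReal_coe_nnreal, ← ENNReal.ofReal_add l.coe_nonneg (by positivity),
    ENNReal.one_le_ofReal]
  have := Real.add_one_le_exp (-(l : ℝ))
  simp only [pow_zero, Nat.factorial_zero, Nat.cast_one, mul_one, div_one]
  linarith

/-- The left side is 1 - (1 + l) e^{-l}, and e^{-l} ≥ 1 - l turns it into at most 1 - (1 + l)(1 -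
l). -/
lemma poissonMeasure_compl_zero_one_le (l : ℝ≥0) : poissonMeasure l {0, 1}ᶜ ≤ l ^ 2 := by
  have hsplit : poissonMeasure l {0, 1} = poissonMeasure l {0} + poissonMeasure l {1} := by
    rw [Set.insert_eq, measure_union (by simp) (measurableSet_singleton 1)]
  rw [prob_compl_eq_one_sub (MeasurableSet.of_discrete), hsplit, poissonMeasure_singleton,
    poissonMeasure_singleton, tsub_le_iff_right, ← ENNReal.ofReal_coe_nnreal,
    ← ENNReal.ofReal_pow l.coe_nonneg, ← ENNReal.ofReal_add (by positivity) (by positivity),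
    ← ENNReal.ofReal_add (by positivity) (by positivity), ENNReal.one_le_ofReal]
  have h1 := Real.add_one_le_exp (-(l : ℝ))
  have h2 : (0 : ℝ) ≤ l := l.coe_nonneg
  simp only [pow_zero, Nat.factorial_zero, Nat.cast_one, mul_one, div_one, pow_one,
    Nat.factorial_one]
  nlinarith

variable {Ω : Type*} [MeasurableSpace Ω] {μ : Measure Ω} {N : Ω → ℕ∞} {l : ℝ≥0}

lemma measure_count_mem (hN : Measurable N)
    (hl : μ.map N = (poissonMeasure l).map (fun n : ℕ => (n : ℕ∞))) (s : Set ℕ∞) :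
    μ {ω | N ω ∈ s} = poissonMeasure l {n | (n : ℕ∞) ∈ s} := by
  have := congrArg (fun ν : Measure ℕ∞ => ν s) hl
  rw [Measure.map_apply hN .of_discrete, Measure.map_apply .of_discrete .of_discrete] at this
  exact this

/-- An identity rather than a bound: it lets the discretized chain inherit the drift inequality
without an error term. -/
lemma measure_count_eq_one (hN : Measurable N)
    (hl : μ.map N = (poissonMeasure l).map (fun n : ℕ => (n : ℕ∞))) :
    μ {ω | N ω = 1} = l * μ {ω | N ω = 0} := by
  have h1 := measure_count_mem hN hl {1}
  have h0 := measure_count_mem hN hl {0}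
  have e1 : {n : ℕ | (n : ℕ∞) ∈ ({1} : Set ℕ∞)} = {1} := by ext; simp
  have e0 : {n : ℕ | (n : ℕ∞) ∈ ({0} : Set ℕ∞)} = {0} := by ext; simp
  simp only [Set.mem_singleton_iff] at h0 h1 e0 e1
  rw [h1, h0, e1, e0, poissonMeasure_singleton, poissonMeasure_singleton,
    ← ENNReal.ofReal_coe_nnreal, ← ENNReal.ofReal_mul l.coe_nonneg]
  congr 1
  simp [mul_comm]

lemma measure_one_le_count (hN : Measurable N)
    (hl : μ.map N = (poissonMeasure l).map (fun n : ℕ => (n : ℕ∞))) :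
    μ {ω | 1 ≤ N ω} ≤ l := by
  refine le_trans (le_of_eq ?_) (poissonMeasure_compl_zero_le l)
  have h1 := measure_count_mem hN hl (Set.Ici 1)
  simp only [Set.mem_Ici] at h1
  rw [h1]
  congr 1
  ext n
  simp [Nat.one_le_iff_ne_zero]

lemma measure_two_le_count (hN : Measurable N)
    (hl : μ.map N = (poissonMeasure l).map (fun n : ℕ => (n : ℕ∞))) :
    μ {ω | 2 ≤ N ω} ≤ l ^ 2 := by
  refine le_trans (le_of_eq ?_) (poissonMeasure_compl_zero_one_le l)
  have h1 := measure_count_mem hN hl (Set.Ici 2)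
  simp only [Set.mem_Ici] at h1
  rw [h1]
  congr 1
  ext n
  have : ((2 : ℕ∞) ≤ (n : ℕ∞)) ↔ 2 ≤ n := by exact_mod_cast Iff.rfl
  simp only [Set.mem_ofPred_eq, this, Set.mem_compl_iff, Set.mem_insert_iff,
    Set.mem_singleton_iff, not_or]
  omega

lemma restrict_quadrant_box {a b c : ℝ} (ha : 0 ≤ a) :
    ((volume : Measure (ℝ × ℝ)).restrict (Set.Ioi 0 ×ˢ Set.Ioi 0)) (Set.Ioc a b ×ˢ Set.Ioo 0 c)
      = ENNReal.ofReal (b - a) * ENNReal.ofReal c := by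
  rw [Measure.restrict_apply (measurableSet_Ioc.prod measurableSet_Ioo),
    Set.inter_eq_left.2 (Set.prod_mono (s₂ := Set.Ioi (0 : ℝ)) (t₂ := Set.Ioi (0 : ℝ))
      (fun x hx => ha.trans_lt hx.1) (fun x hx => hx.1)),
    Measure.volume_eq_prod, Measure.prod_prod, Real.volume_Ioc, Real.volume_Ioo, sub_zero]

variable {V : Type*}

/-- The number of points with mark `m` in the `i`-th time slice of length `h` and below height
`c`. -/
noncomputable def sliceCount (X : Mark V → Ω → Set (ℝ × ℝ)) (h : ℝ) (i : ℕ) (m : Mark V) (c : ℝ)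
    (ω : Ω) : ℕ∞ :=
  (X m ω ∩ Set.Ioc (i * h) ((i + 1) * h) ×ˢ Set.Ioo 0 c).encard

variable {X : Mark V → Ω → Set (ℝ × ℝ)} {h : ℝ}

lemma measurableSet_slice (i : ℕ) (c : ℝ) :
    MeasurableSet (Set.Ioc (i * h) ((i + 1) * h) ×ˢ Set.Ioo 0 c) :=
  measurableSet_Ioc.prod measurableSet_Ioo

lemma measurable_sliceCount
    (hX : ∀ m, IsPoissonPointProcess (X m)
      ((volume : Measure (ℝ × ℝ)).restrict (Set.Ioi 0 ×ˢ Set.Ioi 0)) μ)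
    (i : ℕ) (m : Mark V) (c : ℝ) : Measurable (sliceCount X h i m c) :=
  (hX m).measurable_count _ (measurableSet_slice i c)

lemma law_sliceCount
    (hX : ∀ m, IsPoissonPointProcess (X m)
      ((volume : Measure (ℝ × ℝ)).restrict (Set.Ioi 0 ×ˢ Set.Ioi 0)) μ) (hh : 0 ≤ h)
    (i : ℕ) (m : Mark V) (c : ℝ) :
    μ.map (sliceCount X h i m c)
      = (poissonMeasure (h.toNNReal * c.toNNReal)).map (fun n : ℕ => (n : ℕ∞)) := by
  have hv := restrict_quadrant_box (a := i * h) (b := (i + 1) * h) (c := c) (by positivity)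
  have hsub : ((i : ℝ) + 1) * h - i * h = h := by ring
  rw [hsub] at hv
  have := (hX m).law_count _ (measurableSet_slice (h := h) i c)
    (by rw [hv]; exact ENNReal.mul_ne_top ENNReal.ofReal_ne_top ENNReal.ofReal_ne_top)
  rw [hv, ENNReal.toNNReal_mul] at this
  exact this

lemma disjoint_slice {i j : ℕ} (hij : i ≠ j) (hh : 0 ≤ h) (c d : ℝ) :
    Disjoint (Set.Ioc (i * h) ((i + 1) * h) ×ˢ Set.Ioo 0 c)
      (Set.Ioc (j * h) ((j + 1) * h) ×ˢ Set.Ioo 0 d) := by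
  rw [Set.disjoint_left]
  rintro ⟨r, u⟩ ⟨⟨h1, h2⟩, -⟩ ⟨⟨h3, h4⟩, -⟩
  simp only at h1 h2 h3 h4
  rcases lt_or_gt_of_ne hij with hlt | hlt
  · have : (i : ℝ) + 1 ≤ j := by exact_mod_cast hlt
    nlinarith
  · have : (j : ℝ) + 1 ≤ i := by exact_mod_cast hlt
    nlinarith

/-- Counts of points in different time slices, or with different marks, are independent. -/
lemma iIndepFun_sliceCount [IsProbabilityMeasure μ]
    (hX : ∀ m, IsPoissonPointProcess (X m)
      ((volume : Measure (ℝ × ℝ)).restrict (Set.Ioi 0 ×ˢ Set.Ioi 0)) μ)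
    (hXind : iIndep (fun m => countSigma (X m)) μ) (hh : 0 ≤ h) (g : Mark V → ℕ → ℝ) :
    iIndepFun (fun (q : Mark V × ℕ) ω => sliceCount X h q.2 q.1 (g q.1 q.2) ω) μ := by
  -- Across marks, independence is the hypothesis on the processes; within one mark, the slices are
  -- disjoint boxes, whatever heights are chosen.
  refine iIndepFun_uncurry' (X := fun m i ω => sliceCount X h i m (g m i) ω)
    (fun m i => measurable_sliceCount hX i m _) ?_ fun m => ?_
  · rw [iIndepFun_iff_iIndep]
    refine iIndep_of_iIndep_of_le hXind fun m => ?_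
    rw [← measurable_iff_comap_le, @measurable_pi_iff]
    intro i
    rw [measurable_iff_comap_le]
    exact le_iSup (fun B : {B : Set (ℝ × ℝ) // MeasurableSet B} =>
      MeasurableSpace.comap (fun ω => (X m ω ∩ B.1).encard) ⊤) ⟨_, measurableSet_slice i (g m i)⟩
  · rw [iIndepFun_iff_finset]
    intro s
    have e := s.equivFin.symm
    refine iIndepFun.of_precomp (g := e) e.surjective ?_
    refine (hX m).indep_count s.card (fun k => Set.Ioc ((e k : ℕ) * h) (((e k : ℕ) + 1) * h) ×ˢ
      Set.Ioo 0 (g m (e k))) (fun k => measurableSet_slice _ _) fun k k' hkk => ?_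
    exact disjoint_slice (fun h => hkk (e.injective (Subtype.ext h))) hh _ _

/-- The events determined by a family of counts. -/
@[reducible] noncomputable def countAlgebra (X : Mark V → Ω → Set (ℝ × ℝ)) (h : ℝ) (g : Mark V → ℕ → ℝ)
    (S : Set (Mark V × ℕ)) : MeasurableSpace Ω :=
  ⨆ q ∈ S, MeasurableSpace.comap (sliceCount X h q.2 q.1 (g q.1 q.2)) ⊤

lemma indep_countAlgebra [IsProbabilityMeasure μ]
    (hX : ∀ m, IsPoissonPointProcess (X m)
      ((volume : Measure (ℝ × ℝ)).restrict (Set.Ioi 0 ×ˢ Set.Ioi 0)) μ)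
    (hXind : iIndep (fun m => countSigma (X m)) μ) (hh : 0 ≤ h) (g : Mark V → ℕ → ℝ)
    {S T : Set (Mark V × ℕ)} (hST : Disjoint S T) :
    Indep (countAlgebra X h g S) (countAlgebra X h g T) μ :=
  indep_iSup_of_disjoint
    (m := fun q : Mark V × ℕ => MeasurableSpace.comap (sliceCount X h q.2 q.1 (g q.1 q.2)) ⊤)
    (fun q => measurable_iff_comap_le.1 (measurable_sliceCount hX q.2 q.1 (g q.1 q.2)))
    ((iIndepFun_iff_iIndep ..).1 (iIndepFun_sliceCount hX hXind hh g)) hST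

omit [MeasurableSpace Ω] in
lemma measurableSet_countAlgebra (g : Mark V → ℕ → ℝ) {S : Set (Mark V × ℕ)} {m : Mark V} {i : ℕ}
    (hq : (m, i) ∈ S) (s : Set ℕ∞) :
    MeasurableSet[countAlgebra X h g S] {ω | sliceCount X h i m (g m i) ω ∈ s} := by
  have : MeasurableSpace.comap (sliceCount X h i m (g m i)) ⊤ ≤ countAlgebra X h g S :=
    le_iSup₂_of_le (f := fun (q : Mark V × ℕ) (_ : q ∈ S) =>
      MeasurableSpace.comap (sliceCount X h q.2 q.1 (g q.1 q.2)) ⊤) (m, i) hq le_rfl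
  exact this _ ⟨s, trivial, rfl⟩

lemma countAlgebra_le
    (hX : ∀ m, IsPoissonPointProcess (X m)
      ((volume : Measure (ℝ × ℝ)).restrict (Set.Ioi 0 ×ˢ Set.Ioi 0)) μ)
    (g : Mark V → ℕ → ℝ) (S : Set (Mark V × ℕ)) : countAlgebra X h g S ≤ ‹MeasurableSpace Ω› :=
  iSup₂_le fun q _ => measurable_iff_comap_le.1 (measurable_sliceCount hX q.2 q.1 (g q.1 q.2))

end PoissonCounts

end ReactionDiffusion

namespace ReactionDiffusion

/-! ### Weighted mass, the drift inequality and bounds on rates. -/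

section Weights

variable {V : Type*}

/-- The marks as a sum type. -/
def markEquiv (V : Type*) : (V ⊕ V) ⊕ (V × V) ≃ Mark V where
  toFun
    | .inl (.inl x) => .birth x
    | .inl (.inr x) => .death x
    | .inr (x, y) => .jump x y
  invFun
    | .birth x => .inl (.inl x)
    | .death x => .inl (.inr x)
    | .jump x y => .inr (x, y)
  left_inv := by rintro ((x | x) | ⟨x, y⟩) <;> rfl
  right_inv := by rintro (x | x | ⟨x, y⟩) <;> rfl

instance [Countable V] : Countable (Mark V) := (markEquiv V).symm.injective.countable

lemma tsum_mark (f : Mark V → ℝ≥0∞) :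
    ∑' m, f m = ∑' x, f (.birth x) + ∑' x, f (.death x) + ∑' x, ∑' y, f (.jump x y) := by
  rw [← (markEquiv V).tsum_eq, Summable.tsum_sum ENNReal.summable ENNReal.summable,
    Summable.tsum_sum ENNReal.summable ENNReal.summable, ENNReal.tsum_prod']
  rfl

/-- The total weight of a configuration. -/
noncomputable def weight (w : V → ℝ≥0∞) (z : V → ℕ) : ℝ≥0∞ := ∑' x, w x * z x

lemma weight_mono (w : V → ℝ≥0∞) : Monotone (weight w) := fun z z' h =>
  ENNReal.tsum_le_tsum fun x => by
    have : z x ≤ z' x := h x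
    gcongr

lemma weight_add (w : V → ℝ≥0∞) (z z' : V → ℕ) :
    weight w (z + z') = weight w z + weight w z' := by
  simp only [weight, ← ENNReal.tsum_add, Pi.add_apply, Nat.cast_add, mul_add]

lemma weight_single (w : V → ℝ≥0∞) (x : V) : weight w (single x) = w x := by
  rw [weight, tsum_eq_single x fun y hy => by simp [single_apply_of_ne hy]]
  simp [single_apply_self]

lemma weight_sub_single (w : V → ℝ≥0∞) {z : V → ℕ} {x : V} (hx : z x ≠ 0) :
    weight w (z - single x) + w x = weight w z := by
  rw [← weight_single w x, ← weight_add]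
  congr 1
  ext y
  rcases eq_or_ne y x with rfl | hy
  · simp only [Pi.add_apply, Pi.sub_apply, single_apply_self]
    omega
  · simp [single_apply_of_ne hy]

lemma coe_le_weight_one (z : V → ℕ) (x : V) : (z x : ℝ≥0∞) ≤ weight (fun _ => 1) z := by
  simpa [weight] using ENNReal.le_tsum (f := fun x => (z x : ℝ≥0∞)) x

lemma tsum_ne_top_of_finite_support {f : V → ℝ≥0∞} {s : Set V} (hs : s.Finite)
    (hf : ∀ x, x ∉ s → f x = 0) (hf' : ∀ x, f x ≠ ∞) : ∑' x, f x ≠ ∞ := by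
  rw [tsum_eq_sum (s := hs.toFinset) fun x hx => hf x (by simpa using hx)]
  exact ENNReal.sum_ne_top.2 fun x _ => hf' x

lemma weight_ne_top {w : V → ℝ≥0∞} (hw : ∀ x, w x ≠ ∞) {z : V → ℕ}
    (hz : (Function.support z).Finite) : weight w z ≠ ∞ :=
  tsum_ne_top_of_finite_support hz (fun x hx => by simp [Function.notMem_support.1 hx])
    fun x => ENNReal.mul_ne_top (hw x) (ENNReal.natCast_ne_top _)

lemma finite_support_single (x : V) : (Function.support (single x)).Finite :=
  (Set.finite_singleton x).subset fun y hy => by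
    by_contra h
    exact hy (single_apply_of_ne h)

lemma finite_support_transition {z : V → ℕ} (hz : (Function.support z).Finite) (m : Mark V) :
    (Function.support (transition m z)).Finite := by
  have hsub : ∀ x, (Function.support (z - single x)).Finite := fun x =>
    hz.subset fun y hy h => hy (by
      simp only [Pi.sub_apply]
      omega)
  cases m with
  | birth x => exact (hz.union (finite_support_single x)).subset (Function.support_add _ _)
  | death x => exact hsub x
  | jump x y =>
    exact ((hsub x).union (finite_support_single y)).subset (Function.support_add _ _)

lemma weight_one_transition_le (m : Mark V) (z : V → ℕ) :
    weight (fun _ => 1) (transition m z) ≤ weight (fun _ => 1) z + 1 := by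
  have hle : ∀ x y, transition m z ≤ z + single x → weight (fun _ => 1) (transition m z) ≤
      weight (fun _ => 1) z + (fun _ : V => (1 : ℝ≥0∞)) y := fun x y h => by
    refine (weight_mono _ h).trans ?_
    rw [weight_add, weight_single]
  have hsub : ∀ x, z - single x ≤ z := fun x y => Nat.sub_le _ _
  cases m with
  | birth x => exact hle x x le_rfl
  | death x => exact hle x x ((hsub x).trans fun y => Nat.le_add_right _ _)
  | jump x y => exact hle y y (by
      intro v
      have : (z - single x) v ≤ z v := hsub x v
      change (z - single x) v + single y v ≤ z v + single y v
      omega)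

variable (p : V → V → ℝ) (Fp Fm : ℕ → ℝ)

/-- The total rate of all transitions. -/
noncomputable def totalRate (z : V → ℕ) : ℝ≥0∞ :=
  ∑' m, ENNReal.ofReal (rate p Fp Fm m z)

variable {p Fp Fm}

lemma IsTransitionKernel.tsum_ofReal (hp : IsTransitionKernel p) (x : V) :
    ∑' y, ENNReal.ofReal (p x y) = 1 := by
  rw [← ENNReal.ofReal_tsum_of_nonneg (hp.nonneg x) (hp.hasSum_one x).summable,
    (hp.hasSum_one x).tsum_eq, ENNReal.ofReal_one]

lemma ofReal_rate_jump (hp : IsTransitionKernel p) (x y : V) (z : V → ℕ) :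
    ENNReal.ofReal (rate p Fp Fm (.jump x y) z) = ENNReal.ofReal (p x y) * z x := by
  rw [rate, ENNReal.ofReal_mul (hp.nonneg x y), ENNReal.ofReal_natCast]

/-- The drift inequality. -/
lemma tsum_rate_mul_weight_le (hp : IsTransitionKernel p) (hF : IsReactionPair Fp Fm)
    {w : V → ℝ≥0∞} (hw : ∀ x, w x ≠ ∞) {c : ℝ≥0∞}
    (hpw : ∀ x, ∑' y, ENNReal.ofReal (p x y) * w y ≤ c * w x) {z : V → ℕ}
    (hz : (Function.support z).Finite) :
    ∑' m, ENNReal.ofReal (rate p Fp Fm m z) * weight w (transition m z)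
      ≤ (totalRate p Fp Fm z + c) * weight w z := by
  -- `D` collects the weight lost and `U` the weight gained, on opposite sides of the identity
  -- `hDU`, so that no truncated subtraction occurs. At empty sites the rates vanish, which makes
  -- the identity hold there too.
  let D : Mark V → ℝ≥0∞
    | .birth x => 0
    | .death x => ENNReal.ofReal (Fm (z x)) * w x
    | .jump x y => ENNReal.ofReal (p x y) * (w x * z x)
  let U : Mark V → ℝ≥0∞
    | .birth x => ENNReal.ofReal (Fp (z x)) * w x
    | .death x => 0
    | .jump x y => z x * (ENNReal.ofReal (p x y) * w y)
  have hDU : ∀ m, ENNReal.ofReal (rate p Fp Fm m z) * weight w (transition m z) + D m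
      = ENNReal.ofReal (rate p Fp Fm m z) * weight w z + U m := by
    rintro (x | x | ⟨x, y⟩)
    · simp only [D, U, transition, rate, weight_add, weight_single, add_zero, mul_add]
    · simp only [D, U, transition, rate, add_zero]
      rcases eq_or_ne (z x) 0 with h0 | h0
      · simp [h0, hF.death_zero]
      · rw [← mul_add, weight_sub_single w h0]
    · simp only [D, U, ofReal_rate_jump hp, transition, weight_add, weight_single]
      rcases eq_or_ne (z x) 0 with h0 | h0
      · simp [h0]
      · rw [← weight_sub_single w h0]
        ring
  have hD : ∑' m, D m = ∑' x, ENNReal.ofReal (Fm (z x)) * w x + weight w z := by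
    rw [tsum_mark]
    simp only [D, tsum_zero, zero_add, ENNReal.tsum_mul_right, hp.tsum_ofReal, one_mul, weight]
  -- Finiteness allows the losses to be cancelled at the end; this is where the finite support of
  -- `z` enters.
  have hDtop : ∑' m, D m ≠ ∞ := by
    rw [hD]
    refine ENNReal.add_ne_top.2 ⟨tsum_ne_top_of_finite_support hz (fun x hx => ?_) fun x =>
      ENNReal.mul_ne_top ENNReal.ofReal_ne_top (hw x), weight_ne_top hw hz⟩
    simp [Function.notMem_support.1 hx, hF.death_zero]
  have hU : ∑' m, U m ≤ ∑' m, D m + c * weight w z := by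
    rw [hD, tsum_mark]
    simp only [U, tsum_zero, add_zero, ENNReal.tsum_mul_left]
    rw [add_assoc]
    -- Births are compared with deaths site by site. The weight leaving by jumps, `weight w z`, is
    -- discarded, and the weight arriving is at most `c * weight w z`.
    refine add_le_add (ENNReal.tsum_le_tsum fun x => ?_) (le_add_left ?_)
    · gcongr
      exact hF.birth_le_death _
    · rw [weight, ← ENNReal.tsum_mul_left]
      refine ENNReal.tsum_le_tsum fun x => ?_
      calc (z x : ℝ≥0∞) * ∑' y, ENNReal.ofReal (p x y) * w y ≤ z x * (c * w x) := by
            gcongr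
            exact hpw x
        _ = c * (w x * z x) := by ring
  have hsum := tsum_congr (L := .unconditional _) hDU
  rw [ENNReal.tsum_add, ENNReal.tsum_add, ENNReal.tsum_mul_right] at hsum
  refine (ENNReal.add_le_add_iff_right hDtop).1 ?_
  rw [hsum]
  calc _ ≤ totalRate p Fp Fm z * weight w z + (∑' m, D m + c * weight w z) := by
        gcongr
        exact le_rfl
    _ = _ := by ring

variable (p) in
/-- A bound for the rates, if all values of `Fp` and `Fm` that occur are at most `G`. -/
noncomputable def rateBound (G : ℝ≥0∞) : Mark V → (V → ℕ) → ℝ≥0∞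
  | .birth x, z => G * z x
  | .death x, z => G * z x
  | .jump x y, z => ENNReal.ofReal (p x y) * z x

lemma tsum_rateBound (hp : IsTransitionKernel p) (G : ℝ≥0∞) (z : V → ℕ) :
    ∑' m, rateBound p G m z = (2 * G + 1) * weight (fun _ => 1) z := by
  rw [tsum_mark]
  simp only [rateBound, ENNReal.tsum_mul_left, ENNReal.tsum_mul_right, hp.tsum_ofReal, one_mul,
    weight]
  ring

lemma le_mul_natCast {F : ℕ → ℝ} (h0 : F 0 = 0) {G : ℝ≥0∞} {k n : ℕ}
    (hG : ENNReal.ofReal (F n) ≤ G) (hk : n ≤ k ∨ k ≠ 0) : ENNReal.ofReal (F n) ≤ G * k := by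
  rcases eq_or_ne n 0 with rfl | hn
  · simp [h0]
  · have h1 : (1 : ℝ≥0∞) ≤ k := by
      have : 1 ≤ k := by omega
      exact_mod_cast this
    calc ENNReal.ofReal (F n) ≤ G * 1 := by rwa [mul_one]
      _ ≤ G * k := by gcongr

lemma ofReal_rate_le (hp : IsTransitionKernel p) (hF : IsReactionPair Fp Fm) {G : ℝ≥0∞} {K : ℕ}
    (hG : ∀ n ≤ K, ENNReal.ofReal (Fm n) ≤ G) {z : V → ℕ} (hz : ∀ x, z x ≤ K) (m : Mark V) :
    ENNReal.ofReal (rate p Fp Fm m z) ≤ rateBound p G m z := by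
  cases m with
  | birth x =>
    exact le_mul_natCast hF.birth_zero
      ((ENNReal.ofReal_le_ofReal (hF.birth_le_death _)).trans (hG _ (hz x))) (.inl le_rfl)
  | death x => exact le_mul_natCast hF.death_zero (hG _ (hz x)) (.inl le_rfl)
  | jump x y => exact (ofReal_rate_jump hp x y z).le

/-- A positive rate forces an occupied site, so the new rate is charged to particles of `z`. Without
this hypothesis, births at empty sites could contribute `Fp 1` at infinitely many sites. -/
lemma ofReal_rate_transition_le (hp : IsTransitionKernel p) (hF : IsReactionPair Fp Fm)
    {G : ℝ≥0∞} {K : ℕ} (hG : ∀ n ≤ K + 1, ENNReal.ofReal (Fm n) ≤ G) {z : V → ℕ}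
    (hz : ∀ x, z x ≤ K) {m : Mark V} (hm : 0 < rate p Fp Fm m z) :
    ENNReal.ofReal (rate p Fp Fm m (transition m z)) ≤ rateBound p G m z := by
  cases m with
  | birth x =>
    have h0 : z x ≠ 0 := fun h => by simp [rate, h, hF.birth_zero] at hm
    have := hz x
    refine le_mul_natCast hF.birth_zero
      ((ENNReal.ofReal_le_ofReal (hF.birth_le_death _)).trans (hG _ ?_)) (.inr h0)
    simp only [transition, Pi.add_apply, single_apply_self]
    omega
  | death x =>
    have h0 : z x ≠ 0 := fun h => by simp [rate, h, hF.death_zero] at hm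
    have := hz x
    refine le_mul_natCast hF.death_zero (hG _ ?_) (.inr h0)
    simp only [transition, Pi.sub_apply, single_apply_self]
    omega
  | jump x y =>
    have h0 : z x ≠ 0 := fun h => by simp [rate, h] at hm
    rw [ofReal_rate_jump hp, rateBound]
    gcongr
    rcases eq_or_ne x y with rfl | hxy
    · simp only [transition, Pi.add_apply, Pi.sub_apply, single_apply_self]
      omega
    · simp only [transition, Pi.add_apply, Pi.sub_apply, single_apply_of_ne hxy]
      omega

lemma totalRate_le (hp : IsTransitionKernel p) (hF : IsReactionPair Fp Fm) {G : ℝ≥0∞} {K : ℕ}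
    (hG : ∀ n ≤ K, ENNReal.ofReal (Fm n) ≤ G) {z : V → ℕ} (hz : ∀ x, z x ≤ K) :
    totalRate p Fp Fm z ≤ (2 * G + 1) * weight (fun _ => 1) z :=
  (ENNReal.tsum_le_tsum fun m => ofReal_rate_le hp hF hG hz m).trans (tsum_rateBound hp G z).le

/-- The rate of pairs of transitions from configurations of bounded mass. -/
lemma exists_pair_rate_bound (hp : IsTransitionKernel p) (hF : IsReactionPair Fp Fm) (K : ℕ) :
    ∃ D : ℝ≥0∞, D ≠ ∞ ∧ ∀ z : V → ℕ, weight (fun _ => 1) z ≤ K →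
      ∑' m, ENNReal.ofReal (rate p Fp Fm m z) *
          (∑' m', ENNReal.ofReal (max (rate p Fp Fm m' z) (rate p Fp Fm m' (transition m z)))) +
        ∑' m, (if 0 < rate p Fp Fm m z then
          ENNReal.ofReal (max (rate p Fp Fm m z) (rate p Fp Fm m (transition m z))) else 0) ^ 2
        ≤ D := by
  -- `G` dominates the values of `Fm` up to `K + 1`, since one transition can add a particle to a
  -- configuration of mass `K`.
  set G : ℝ≥0∞ := ∑ n ∈ Finset.range (K + 2), ENNReal.ofReal (Fm n) with hGdef
  have hGtop : G ≠ ∞ := ENNReal.sum_ne_top.2 fun _ _ => ENNReal.ofReal_ne_top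
  have hG : ∀ n ≤ K + 1, ENNReal.ofReal (Fm n) ≤ G := fun n hn =>
    Finset.single_le_sum (f := fun n => ENNReal.ofReal (Fm n)) (fun _ _ => zero_le)
      (Finset.mem_range.2 (by omega))
  refine ⟨((2 * G + 1) * K) * ((2 * G + 1) * K + (2 * G + 1) * (K + 1)) + ((2 * G + 1) * K) ^ 2,
    ?_, fun z hz => ?_⟩
  · finiteness
  have hzK : ∀ x, z x ≤ K := fun x => by exact_mod_cast (coe_le_weight_one z x).trans hz
  have hlam : totalRate p Fp Fm z ≤ (2 * G + 1) * K :=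
    (totalRate_le hp hF (fun n hn => hG n (by omega)) hzK).trans (by gcongr)
  refine add_le_add ?_ ?_
  · refine (ENNReal.tsum_le_tsum fun m => ?_).trans
      (ENNReal.tsum_mul_right.le.trans (mul_le_mul_left hlam _))
    gcongr
    have hmass : weight (fun _ => 1) (transition m z) ≤ K + 1 :=
      (weight_one_transition_le m z).trans (by gcongr)
    have hmK : ∀ x, transition m z x ≤ K + 1 := fun x => by
      exact_mod_cast (coe_le_weight_one _ x).trans hmass
    calc ∑' m', ENNReal.ofReal (max (rate p Fp Fm m' z) (rate p Fp Fm m' (transition m z)))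
        ≤ ∑' m', (ENNReal.ofReal (rate p Fp Fm m' z)
          + ENNReal.ofReal (rate p Fp Fm m' (transition m z))) := by
          refine ENNReal.tsum_le_tsum fun m' => ?_
          rw [ENNReal.ofReal_max]
          exact max_le_add_of_nonneg (zero_le) (zero_le)
      _ = totalRate p Fp Fm z + totalRate p Fp Fm (transition m z) := ENNReal.tsum_add
      _ ≤ _ := add_le_add hlam ((totalRate_le hp hF hG hmK).trans (by gcongr))
  · set f : Mark V → ℝ≥0∞ := fun m => if 0 < rate p Fp Fm m z then
      ENNReal.ofReal (max (rate p Fp Fm m z) (rate p Fp Fm m (transition m z))) else 0 with hf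
    have hfle : ∑' m, f m ≤ (2 * G + 1) * K := by
      refine (ENNReal.tsum_le_tsum fun m => ?_).trans
        ((tsum_rateBound hp G z).le.trans (by gcongr))
      simp only [hf]
      split_ifs with hm
      · rw [ENNReal.ofReal_max]
        exact max_le (ofReal_rate_le hp hF (fun n hn => hG n (by omega)) hzK m)
          (ofReal_rate_transition_le hp hF hG hzK hm)
      · exact zero_le
    -- The sum of squares is at most the square of the sum.
    calc ∑' m, f m ^ 2 ≤ ∑' m, f m * ∑' m', f m' := by
          refine ENNReal.tsum_le_tsum fun m => ?_
          rw [sq]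
          gcongr
          exact ENNReal.le_tsum m
      _ = (∑' m, f m) ^ 2 := by rw [ENNReal.tsum_mul_right, sq]
      _ ≤ _ := by gcongr

end Weights

end ReactionDiffusion

namespace ReactionDiffusion

/-! ### The discretized chain and its pathwise agreement with the flow. -/

section Chain

variable {V Ω : Type*}

/-- In the `i`-th slice there is a single point that is relevant for `z`, and its mark is `m`. -/
def OnlyMark (p : V → V → ℝ) (Fp Fm : ℕ → ℝ) (X : Mark V → Ω → Set (ℝ × ℝ)) (h : ℝ) (i : ℕ)
    (z : V → ℕ) (ω : Ω) (m : Mark V) : Prop :=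
  sliceCount X h i m (rate p Fp Fm m z) ω = 1 ∧
    ∀ m', m' ≠ m → sliceCount X h i m' (rate p Fp Fm m' z) ω = 0

open Classical in
/-- The mark of the single relevant point of the `i`-th slice, if there is just one such point. -/
noncomputable def sliceMark (p : V → V → ℝ) (Fp Fm : ℕ → ℝ) (X : Mark V → Ω → Set (ℝ × ℝ)) (h : ℝ)
    (i : ℕ) (z : V → ℕ) (ω : Ω) : Option (Mark V) :=
  if hm : ∃ m, OnlyMark p Fp Fm X h i z ω m then some hm.choose else none

/-- Apply a transition, if there is one. -/
noncomputable def applyMark : Option (Mark V) → (V → ℕ) → (V → ℕ)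
  | none, z => z
  | some m, z => transition m z

/-- The configuration reached from `z` by a list of transitions, the most recent one first. -/
noncomputable def confOf (z : V → ℕ) : List (Option (Mark V)) → (V → ℕ)
  | [] => z
  | o :: l => applyMark o (confOf z l)

/-- The marks used in the first slices by the discretized dynamics, the most recent one first. -/
noncomputable def history (p : V → V → ℝ) (Fp Fm : ℕ → ℝ) (X : Mark V → Ω → Set (ℝ × ℝ)) (h : ℝ)
    (z : V → ℕ) (ω : Ω) : ℕ → List (Option (Mark V))
  | 0 => []
  | j + 1 => sliceMark p Fp Fm X h j (confOf z (history p Fp Fm X h z ω j)) ω ::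
      history p Fp Fm X h z ω j

/-- In the `i`-th slice there may be two relevant points when it is entered in the
configuration `z`. -/
def Bad (p : V → V → ℝ) (Fp Fm : ℕ → ℝ) (X : Mark V → Ω → Set (ℝ × ℝ)) (h : ℝ) (i : ℕ)
    (z : V → ℕ) (ω : Ω) : Prop :=
  ∃ m, (∃ m', m' ≠ m ∧ 1 ≤ sliceCount X h i m (rate p Fp Fm m z) ω ∧
      1 ≤ sliceCount X h i m'
        (max (rate p Fp Fm m' z) (rate p Fp Fm m' (transition m z))) ω) ∨
    (0 < rate p Fp Fm m z ∧
      2 ≤ sliceCount X h i m (max (rate p Fp Fm m z) (rate p Fp Fm m (transition m z))) ω)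

variable {p : V → V → ℝ} {Fp Fm : ℕ → ℝ} {X : Mark V → Ω → Set (ℝ × ℝ)} {h : ℝ}

lemma finite_support_confOf {z : V → ℕ} (hz : (Function.support z).Finite)
    (l : List (Option (Mark V))) : (Function.support (confOf z l)).Finite := by
  induction l with
  | nil => exact hz
  | cons o l ih =>
    cases o with
    | none => exact ih
    | some m => exact finite_support_transition ih m

lemma OnlyMark.unique {i : ℕ} {z : V → ℕ} {ω : Ω} {m m' : Mark V}
    (hm : OnlyMark p Fp Fm X h i z ω m) (hm' : OnlyMark p Fp Fm X h i z ω m') : m = m' := by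
  by_contra hne
  exact one_ne_zero (hm.1.symm.trans (hm'.2 m hne))

lemma sliceMark_eq_some_iff {i : ℕ} {z : V → ℕ} {ω : Ω} {m : Mark V} :
    sliceMark p Fp Fm X h i z ω = some m ↔ OnlyMark p Fp Fm X h i z ω m := by
  classical
  rw [sliceMark]
  split_ifs with hex
  · rw [Option.some_inj]
    exact ⟨fun hm => hm ▸ hex.choose_spec, fun hm => hex.choose_spec.unique hm⟩
  · exact ⟨fun hm => by simp at hm, fun hm => absurd ⟨m, hm⟩ hex⟩

lemma sliceCount_mono {i : ℕ} {m : Mark V} {c d : ℝ} (hcd : c ≤ d) (ω : Ω) :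
    sliceCount X h i m c ω ≤ sliceCount X h i m d ω :=
  Set.encard_le_encard (Set.inter_subset_inter_right _
    (Set.prod_mono le_rfl (Set.Ioo_subset_Ioo_right hcd)))

lemma one_le_sliceCount {i : ℕ} {m : Mark V} {c r u : ℝ} {ω : Ω} (hmem : (r, u) ∈ X m ω)
    (hr : i * h < r) (hr' : r ≤ (i + 1) * h) (hu : 0 < u) (hc : u < c) :
    1 ≤ sliceCount X h i m c ω :=
  Set.one_le_encard_iff_nonempty.2 ⟨(r, u), hmem, ⟨hr, hr'⟩, hu, hc⟩

lemma two_le_sliceCount {i : ℕ} {m : Mark V} {c : ℝ} {q q' : ℝ × ℝ} {ω : Ω} (hne : q ≠ q')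
    (hq : q ∈ X m ω ∩ Set.Ioc (i * h) ((i + 1) * h) ×ˢ Set.Ioo 0 c)
    (hq' : q' ∈ X m ω ∩ Set.Ioc (i * h) ((i + 1) * h) ×ˢ Set.Ioo 0 c) :
    2 ≤ sliceCount X h i m c ω := by
  rw [← Set.encard_pair hne]
  exact Set.encard_le_encard (Set.insert_subset hq (Set.singleton_subset_iff.2 hq'))

/-- If a slice is not bad then a mark that has a relevant point is the only one. -/
lemma onlyMark_of_not_bad {i : ℕ} {z : V → ℕ} {ω : Ω} (hbad : ¬ Bad p Fp Fm X h i z ω) {m : Mark V}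
    {r : ℝ} (hr : i * h < r) (hr' : r ≤ (i + 1) * h)
    (hm : m ∈ activeMarks p Fp Fm (fun m => X m ω) r z) : OnlyMark p Fp Fm X h i z ω m := by
  obtain ⟨u, hu, hmem, hlt⟩ := hm
  have h1 := one_le_sliceCount hmem hr hr' hu hlt
  simp only [Bad, not_exists, not_or, not_and, not_le] at hbad
  obtain ⟨hb1, hb2⟩ := hbad m
  constructor
  · refine le_antisymm ?_ h1
    have := (sliceCount_mono (le_max_left _ _) ω).trans_lt (hb2 (hu.trans hlt))
    exact Order.le_of_lt_add_one (by simpa [one_add_one_eq_two] using this)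
  · intro m' hne
    have := (sliceCount_mono (le_max_left _ _) ω).trans_lt (hb1 m' hne h1)
    simpa using this

/-- In a slice that is not bad, the dynamics makes the transition of `sliceMark`. -/
lemma evolves_of_not_bad (hh : 0 ≤ h) {i : ℕ} {z : V → ℕ} {ω : Ω}
    (hbad : ¬ Bad p Fp Fm X h i z ω) :
    (∃ n, Evolves p Fp Fm (fun m => X m ω) (i * h) z ((i + 1) * h)
      (applyMark (sliceMark p Fp Fm X h i z ω) z) n) ∧
    ∀ t, i * h ≤ t → t ≤ (i + 1) * h →
      (∃ n, Evolves p Fp Fm (fun m => X m ω) (i * h) z t z n) ∨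
      (∃ n, Evolves p Fp Fm (fun m => X m ω) (i * h) z t
        (applyMark (sliceMark p Fp Fm X h i z ω) z) n) := by
  have hle : i * h ≤ (i + 1) * h := by nlinarith
  cases hs : sliceMark p Fp Fm X h i z ω with
  | none =>
    have hq : ∀ r, i * h < r → r ≤ (i + 1) * h →
        activeMarks p Fp Fm (fun m => X m ω) r z = ∅ := by
      intro r hr hr'
      rw [Set.eq_empty_iff_forall_notMem]
      intro m hm
      have := sliceMark_eq_some_iff.2 (onlyMark_of_not_bad hbad hr hr' hm)
      rw [hs] at this
      exact Option.some_ne_none m this.symm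
    exact ⟨⟨0, .rest hle hq⟩, fun t ht ht' =>
      .inl ⟨0, .rest ht fun r hr hr' => hq r hr (hr'.trans ht')⟩⟩
  | some m =>
    have hm := sliceMark_eq_some_iff.1 hs
    obtain ⟨⟨r, u⟩, hru⟩ := Set.encard_eq_one.1 hm.1
    have hmem : (r, u) ∈ X m ω ∩ Set.Ioc (i * h) ((i + 1) * h) ×ˢ
        Set.Ioo 0 (rate p Fp Fm m z) := hru ▸ Set.mem_singleton _
    obtain ⟨hX, ⟨hr, hr'⟩, hu, hu'⟩ := hmem
    simp only at hr hr' hu hu'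
    have huniq : ∀ r', i * h < r' → r' ≤ (i + 1) * h → ∀ m',
        m' ∈ activeMarks p Fp Fm (fun m => X m ω) r' z → m' = m ∧ r' = r := by
      intro r' h1 h2 m' hm'
      obtain rfl := (onlyMark_of_not_bad hbad h1 h2 hm').unique hm
      obtain ⟨u', hu0, hX', hlt⟩ := hm'
      have : (r', u') ∈ ({(r, u)} : Set (ℝ × ℝ)) := by
        rw [← hru]
        exact ⟨hX', ⟨h1, h2⟩, hu0, hlt⟩
      exact ⟨rfl, congrArg Prod.fst (Set.mem_singleton_iff.1 this)⟩
    have hq : ∀ r', i * h < r' → r' < r → activeMarks p Fp Fm (fun m => X m ω) r' z = ∅ := by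
      intro r' h1 h2
      rw [Set.eq_empty_iff_forall_notMem]
      intro m' hm'
      exact h2.ne (huniq r' h1 (h2.le.trans hr') m' hm').2
    have hact : activeMarks p Fp Fm (fun m => X m ω) r z = {m} := by
      ext m'
      rw [Set.mem_singleton_iff]
      refine ⟨fun hm' => (huniq r hr hr' m' hm').1, ?_⟩
      rintro rfl
      exact ⟨u, hu, hX, hu'⟩
    have hq' : ∀ r', r < r' → r' ≤ (i + 1) * h →
        activeMarks p Fp Fm (fun m => X m ω) r' (transition m z) = ∅ := by
      intro r' h1 h2
      rw [Set.eq_empty_iff_forall_notMem]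
      rintro m' ⟨u', hu0, hX', hlt⟩
      have hlt' := hlt.trans_le (le_max_right (rate p Fp Fm m' z) _)
      -- A later relevant point lies below the rate after the transition, hence below the maximum of
      -- rates in `Bad`: it is a second point of the slice, of the same mark or of another.
      refine hbad ⟨m, ?_⟩
      rcases eq_or_ne m' m with rfl | hne
      · refine .inr ⟨hu.trans hu', two_le_sliceCount (q := (r, u)) (q' := (r', u')) ?_
          ⟨hX, ⟨hr, hr'⟩, hu, hu'.trans_le (le_max_left _ _)⟩ ⟨hX', ⟨hr.trans h1, h2⟩, hu0, hlt'⟩⟩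
        exact fun he => h1.ne (congrArg Prod.fst he)
      · exact .inl ⟨m', hne, one_le_sliceCount hX hr hr' hu hu',
          one_le_sliceCount hX' (hr.trans h1) h2 hu0 hlt'⟩
    have hev : ∀ t, r ≤ t → t ≤ (i + 1) * h →
        Evolves p Fp Fm (fun m => X m ω) (i * h) z t (transition m z) (0 + 1) := fun t ht ht' =>
      .jump hr ht hq hact (.rest ht fun r' h1 h2 => hq' r' h1 (h2.trans ht'))
    refine ⟨⟨_, hev _ hr' le_rfl⟩, fun t ht ht' => ?_⟩
    rcases lt_or_ge t r with htr | htr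
    · exact .inl ⟨0, .rest ht fun r' h1 h2 => hq r' h1 (h2.trans_lt htr)⟩
    · exact .inr ⟨_, hev t htr ht'⟩

/-- As long as no slice is bad, the discretized dynamics agrees with the flow. -/
lemma exists_evolves_history (hh : 0 ≤ h) {z : V → ℕ} {ω : Ω} (n : ℕ)
    (hbad : ∀ i < n, ¬ Bad p Fp Fm X h i (confOf z (history p Fp Fm X h z ω i)) ω) :
    (∃ k, Evolves p Fp Fm (fun m => X m ω) 0 z (n * h)
      (confOf z (history p Fp Fm X h z ω n)) k) ∧
    ∀ t, 0 ≤ t → t ≤ n * h → ∃ j ≤ n, ∃ k, Evolves p Fp Fm (fun m => X m ω) 0 z t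
      (confOf z (history p Fp Fm X h z ω j)) k := by
  induction n with
  | zero =>
    have h0 : Evolves p Fp Fm (fun m => X m ω) 0 z 0 z 0 :=
      .rest le_rfl fun r h1 h2 => absurd h1 h2.not_gt
    refine ⟨⟨0, by simpa [history, confOf] using h0⟩, fun t ht ht' => ⟨0, le_rfl, 0, ?_⟩⟩
    obtain rfl : t = 0 := le_antisymm (by simpa using ht') ht
    exact h0
  | succ n ih =>
    obtain ⟨⟨k, hk⟩, ih2⟩ := ih fun i hi => hbad i (hi.trans n.lt_succ_self)
    obtain ⟨⟨k', hk'⟩, hstep⟩ := evolves_of_not_bad hh (hbad n n.lt_succ_self)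
    push_cast
    refine ⟨⟨k + k', hk.trans hk'⟩, fun t ht ht' => ?_⟩
    rcases le_or_gt t (n * h) with htn | htn
    · obtain ⟨j, hj, k, hk⟩ := ih2 t ht htn
      exact ⟨j, hj.trans n.le_succ, k, hk⟩
    · rcases hstep t htn.le ht' with ⟨k', hk'⟩ | ⟨k', hk'⟩
      · exact ⟨n, n.le_succ, k + k', hk.trans hk'⟩
      · exact ⟨n + 1, le_rfl, k + k', hk.trans hk'⟩

/-! ### Measurability of the chain and independence of its past. -/

section Measure

variable [Countable V]

lemma measurableSet_sliceMark {g : Mark V → ℕ → ℝ} {i : ℕ} {z : V → ℕ}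
    (hg : ∀ m, g m i = rate p Fp Fm m z) (o : Option (Mark V)) {S : Set (Mark V × ℕ)}
    (hS : ∀ m, (m, i) ∈ S) :
    MeasurableSet[countAlgebra X h g S] {ω | sliceMark p Fp Fm X h i z ω = o} := by
  have hcount : ∀ (m : Mark V) (s : Set ℕ∞), MeasurableSet[countAlgebra X h g S]
      {ω | sliceCount X h i m (rate p Fp Fm m z) ω ∈ s} := fun m s => by
    simpa only [hg] using measurableSet_countAlgebra (X := X) (h := h) g (hS m) s
  have hsome : ∀ m, MeasurableSet[countAlgebra X h g S]
      {ω | sliceMark p Fp Fm X h i z ω = some m} := fun m => by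
    have e : {ω | sliceMark p Fp Fm X h i z ω = some m} =
        {ω | sliceCount X h i m (rate p Fp Fm m z) ω ∈ ({1} : Set ℕ∞)} ∩
          ⋂ m', ⋂ _ : m' ≠ m, {ω | sliceCount X h i m' (rate p Fp Fm m' z) ω ∈ ({0} : Set ℕ∞)} := by
      ext ω
      simp [sliceMark_eq_some_iff, OnlyMark]
    rw [e]
    exact (hcount m _).inter (.iInter fun m' => .iInter fun _ => hcount m' _)
  cases o with
  | some m => exact hsome m
  | none =>
    have e : {ω | sliceMark p Fp Fm X h i z ω = none} =
        (⋃ m, {ω | sliceMark p Fp Fm X h i z ω = some m})ᶜ := by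
      ext ω
      simp [Option.eq_none_iff_forall_ne_some]
    rw [e]
    exact (MeasurableSet.iUnion hsome).compl

/-- The heights below which points count depend on the random configuration, but fixing the whole
history makes them deterministic. Allowing every `g'` that agrees with `g` before slice `j` leaves
the heights from slice `j` on free for later use. -/
lemma exists_measurableSet_history (z : V → ℕ) (j : ℕ) : ∀ l : List (Option (Mark V)),
    ∃ g : Mark V → ℕ → ℝ, ∀ g' : Mark V → ℕ → ℝ, (∀ m, ∀ i < j, g' m i = g m i) →
      MeasurableSet[countAlgebra X h g' {q | q.2 < j}] {ω | history p Fp Fm X h z ω j = l} := by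
  induction j with
  | zero =>
    intro l
    refine ⟨fun _ _ => 0, fun g' _ => ?_⟩
    simp only [history]
    exact .const _
  | succ j ih =>
    rintro (- | ⟨o, l⟩)
    · refine ⟨fun _ _ => 0, fun g' _ => ?_⟩
      simp [history]
    · obtain ⟨g, hg⟩ := ih l
      refine ⟨fun m i => if i < j then g m i else rate p Fp Fm m (confOf z l), fun g' hg' => ?_⟩
      have e : {ω | history p Fp Fm X h z ω (j + 1) = o :: l} =
          {ω | history p Fp Fm X h z ω j = l} ∩
            {ω | sliceMark p Fp Fm X h j (confOf z l) ω = o} := by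
        ext ω
        simp only [history, List.cons.injEq, Set.mem_ofPred_eq, Set.mem_inter_iff]
        constructor
        · rintro ⟨h1, h2⟩
          exact ⟨h2, h2 ▸ h1⟩
        · rintro ⟨h1, h2⟩
          exact ⟨h1 ▸ h2, h1⟩
      rw [e]
      refine .inter ?_ (measurableSet_sliceMark (fun m => ?_) o fun m => ?_)
      · have hle : countAlgebra X h g' {q | q.2 < j} ≤ countAlgebra X h g' {q | q.2 < j + 1} :=
          biSup_mono fun q (hq : q.2 < j) => hq.trans j.lt_succ_self
        refine hle _ (hg g' fun m i hi => ?_)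
        exact (hg' m i (hi.trans j.lt_succ_self)).trans (if_pos hi)
      · exact (hg' m j j.lt_succ_self).trans (if_neg (lt_irrefl j))
      · exact j.lt_succ_self

variable [MeasurableSpace Ω] {μ : Measure Ω}

lemma measurableSet_history
    (hX : ∀ m, IsPoissonPointProcess (X m)
      ((volume : Measure (ℝ × ℝ)).restrict (Set.Ioi 0 ×ˢ Set.Ioi 0)) μ)
    (z : V → ℕ) (j : ℕ) (l : List (Option (Mark V))) :
    MeasurableSet {ω | history p Fp Fm X h z ω j = l} := by
  obtain ⟨g, hg⟩ := exists_measurableSet_history (p := p) (Fp := Fp) (Fm := Fm) (X := X) (h := h)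
    z j l
  exact countAlgebra_le hX g _ _ (hg g fun _ _ _ => rfl)

lemma measurableSet_sliceMark'
    (hX : ∀ m, IsPoissonPointProcess (X m)
      ((volume : Measure (ℝ × ℝ)).restrict (Set.Ioi 0 ×ˢ Set.Ioi 0)) μ)
    (i : ℕ) (z : V → ℕ) (o : Option (Mark V)) :
    MeasurableSet {ω | sliceMark p Fp Fm X h i z ω = o} :=
  countAlgebra_le hX (fun m _ => rate p Fp Fm m z) Set.univ _
    (measurableSet_sliceMark (fun _ => rfl) o fun _ => Set.mem_univ _)

variable [IsProbabilityMeasure μ]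

/-- The past of the discretized dynamics is independent of the next slice. -/
lemma measure_history_inter
    (hX : ∀ m, IsPoissonPointProcess (X m)
      ((volume : Measure (ℝ × ℝ)).restrict (Set.Ioi 0 ×ˢ Set.Ioi 0)) μ)
    (hXind : iIndep (fun m => countSigma (X m)) μ) (hh : 0 ≤ h) (z : V → ℕ) (j : ℕ)
    (l : List (Option (Mark V))) (g : Mark V → ℕ → ℝ) {S : Set Ω}
    (hS : MeasurableSet[countAlgebra X h g {q | q.2 = j}] S) :
    μ ({ω | history p Fp Fm X h z ω j = l} ∩ S)
      = μ {ω | history p Fp Fm X h z ω j = l} * μ S := by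
  obtain ⟨g₀, hg₀⟩ := exists_measurableSet_history (p := p) (Fp := Fp) (Fm := Fm) (X := X) (h := h)
    z j l
  -- Heights of the history before slice `j`, heights of `S` from then on: both events become
  -- functions of a single independent family of counts.
  set g' : Mark V → ℕ → ℝ := fun m i => if i < j then g₀ m i else g m i with hg'
  have hle : countAlgebra X h g {q | q.2 = j} ≤ countAlgebra X h g' {q | q.2 = j} := by
    refine iSup₂_mono fun q hq => ?_
    have hq : q.2 = j := hq
    simp only [hg', hq, lt_irrefl, if_false, le_refl]
  refine (Indep_iff _ _ μ).1 (indep_countAlgebra hX hXind hh g'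
    (S := {q | q.2 < j}) (T := {q | q.2 = j}) ?_) _ _ (hg₀ g' fun m i hi => if_pos hi) (hle _ hS)
  rw [Set.disjoint_left]
  exact fun q (h1 : q.2 < j) (h2 : q.2 = j) => h1.ne h2

end Measure

end Chain

end ReactionDiffusion

namespace ReactionDiffusion

/-! ### Expectations, maximal inequality and bad slices for the chain. -/

section ChainEstimates

lemma tsum_option {β : Type*} (f : Option β → ℝ≥0∞) : ∑' o, f o = f none + ∑' b, f (some b) := by
  rw [← (Equiv.optionEquivSumPUnit.{0} β).symm.tsum_eq, Summable.tsum_sum ENNReal.summable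
    ENNReal.summable, add_comm]
  simp

/-- The expectation of a function of a random variable with countably many values. -/
lemma lintegral_comp_countable {Ω L : Type*} [MeasurableSpace Ω] {μ : Measure Ω} [Countable L]
    {Y : Ω → L} (hY : ∀ l, MeasurableSet {ω | Y ω = l}) (f : L → ℝ≥0∞) :
    Measurable (fun ω => f (Y ω)) ∧ ∫⁻ ω, f (Y ω) ∂μ = ∑' l, μ {ω | Y ω = l} * f l := by
  let _ : MeasurableSpace L := ⊤
  have : DiscreteMeasurableSpace L := ⟨fun _ => trivial⟩
  have hYm : Measurable Y := measurable_to_countable' hY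
  have hf : Measurable f := .of_discrete
  refine ⟨hf.comp hYm, ?_⟩
  rw [← lintegral_map hf hYm, lintegral_countable']
  refine tsum_congr fun l => ?_
  rw [Measure.map_apply hYm (measurableSet_singleton l), mul_comm]
  rfl

variable {V Ω : Type*} {p : V → V → ℝ} {Fp Fm : ℕ → ℝ} {X : Mark V → Ω → Set (ℝ × ℝ)} {h : ℝ}

/-- The process of values of `f`, stopped when it exceeds `A`. -/
noncomputable def stopped (f : (V → ℕ) → ℝ≥0∞) (A : ℝ≥0∞) (z : V → ℕ) :
    List (Option (Mark V)) → ℝ≥0∞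
  | [] => f z
  | o :: l => if A < stopped f A z l then stopped f A z l else f (confOf z (o :: l))

lemma stopped_eq {f : (V → ℕ) → ℝ≥0∞} {A : ℝ≥0∞} {z : V → ℕ} {l : List (Option (Mark V))}
    (hl : ¬ A < stopped f A z l) : stopped f A z l = f (confOf z l) := by
  cases l with
  | nil => rfl
  | cons o l =>
    rw [stopped] at hl ⊢
    by_cases h1 : A < stopped f A z l
    · rw [if_pos h1] at hl
      exact absurd h1 hl
    · rw [if_neg h1]

/-- The stopped process freezes at its first value above `A`, so an exceedance in the past is still
visible at time `j`. A maximal inequality thereby reduces to Markov's inequality at one time. -/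
lemma lt_stopped_history {f : (V → ℕ) → ℝ≥0∞} {A : ℝ≥0∞} {z : V → ℕ} {ω : Ω} {i j : ℕ}
    (hij : i ≤ j) (hi : A < f (confOf z (history p Fp Fm X h z ω i))) :
    A < stopped f A z (history p Fp Fm X h z ω j) := by
  induction j, hij using Nat.le_induction with
  | base =>
    by_contra hlt
    exact hlt (by rwa [stopped_eq hlt])
  | succ j hij ih =>
    rw [history, stopped, if_pos ih]
    exact ih

variable [Countable V] [MeasurableSpace Ω] {μ : Measure Ω} [IsProbabilityMeasure μ]
  (hX : ∀ m, IsPoissonPointProcess (X m)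
    ((volume : Measure (ℝ × ℝ)).restrict (Set.Ioi 0 ×ˢ Set.Ioi 0)) μ)
  (hXind : iIndep (fun m => countSigma (X m)) μ)

include hX hXind

/-- By independence only the factor of `m` changes between "no relevant point" and "one relevant
point, of mark `m`", and for a Poisson count this factor changes by its mean. The last factor does
not depend on `m`, so the marks are chosen in proportion to their rates. -/
lemma measure_sliceMark_eq_some (hh : 0 ≤ h) (i : ℕ) (z : V → ℕ) (m : Mark V) :
    μ {ω | sliceMark p Fp Fm X h i z ω = some m}
      = ENNReal.ofReal h * ENNReal.ofReal (rate p Fp Fm m z) *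
        μ {ω | ∀ m, sliceCount X h i m (rate p Fp Fm m z) ω = 0} := by
  set g : Mark V → ℕ → ℝ := fun m _ => rate p Fp Fm m z with hg
  set B : Set Ω := ⋂ m', ⋂ _ : m' ≠ m,
    {ω | sliceCount X h i m' (rate p Fp Fm m' z) ω ∈ ({0} : Set ℕ∞)} with hB
  have hBm : MeasurableSet[countAlgebra X h g {q | q ≠ (m, i)}] B :=
    .iInter fun m' => .iInter fun hm' => measurableSet_countAlgebra g
      (show (m', i) ∈ {q : Mark V × ℕ | q ≠ (m, i)} from fun he => hm' (congrArg Prod.fst he)) _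
  have hdisj : Disjoint {(m, i)} {q : Mark V × ℕ | q ≠ (m, i)} := by simp
  have hind : ∀ s : Set ℕ∞, μ ({ω | sliceCount X h i m (rate p Fp Fm m z) ω ∈ s} ∩ B)
      = μ {ω | sliceCount X h i m (rate p Fp Fm m z) ω ∈ s} * μ B := fun s =>
    (Indep_iff _ _ μ).1 (indep_countAlgebra hX hXind hh g hdisj) _ _
      (measurableSet_countAlgebra g (Set.mem_singleton _) s) hBm
  have e1 : {ω | sliceMark p Fp Fm X h i z ω = some m} =
      {ω | sliceCount X h i m (rate p Fp Fm m z) ω ∈ ({1} : Set ℕ∞)} ∩ B := by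
    ext ω
    simp [sliceMark_eq_some_iff, OnlyMark, hB]
  have e0 : {ω | ∀ m, sliceCount X h i m (rate p Fp Fm m z) ω = 0} =
      {ω | sliceCount X h i m (rate p Fp Fm m z) ω ∈ ({0} : Set ℕ∞)} ∩ B := by
    ext ω
    simp only [hB, Set.mem_singleton_iff, Set.mem_ofPred_eq, Set.mem_inter_iff, Set.mem_iInter]
    refine ⟨fun h1 => ⟨h1 m, fun m' _ => h1 m'⟩, fun h1 m' => ?_⟩
    rcases eq_or_ne m' m with rfl | hne
    exacts [h1.1, h1.2 m' hne]
  have hone := measure_count_eq_one (measurable_sliceCount hX i m (rate p Fp Fm m z))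
    (law_sliceCount hX hh i m (rate p Fp Fm m z))
  rw [e1, e0, hind, hind]
  simp only [Set.mem_singleton_iff, hone, ENNReal.coe_mul, mul_assoc]
  rfl

lemma tsum_measure_sliceMark_mul_weight_le (hh : 0 ≤ h) (hp : IsTransitionKernel p)
    (hF : IsReactionPair Fp Fm) {w : V → ℝ≥0∞} (hw : ∀ x, w x ≠ ∞) {c : ℝ≥0∞}
    (hpw : ∀ x, ∑' y, ENNReal.ofReal (p x y) * w y ≤ c * w x) {z : V → ℕ}
    (hz : (Function.support z).Finite) (i : ℕ) :
    ∑' o, μ {ω | sliceMark p Fp Fm X h i z ω = o} * weight w (applyMark o z)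
      ≤ (1 + ENNReal.ofReal h * c) * weight w z := by
  set Q := μ {ω | ∀ m, sliceCount X h i m (rate p Fp Fm m z) ω = 0} with hQ
  have hone : ∑' o, μ {ω | sliceMark p Fp Fm X h i z ω = o} = 1 := by
    have := (lintegral_comp_countable (μ := μ)
      (measurableSet_sliceMark' (p := p) (Fp := Fp) (Fm := Fm) (h := h) hX i z) fun _ => 1).2
    simpa using this.symm
  rw [tsum_option] at hone ⊢
  have hsome : ∀ m, μ {ω | sliceMark p Fp Fm X h i z ω = some m} =
      ENNReal.ofReal h * Q * ENNReal.ofReal (rate p Fp Fm m z) := fun m => by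
    rw [measure_sliceMark_eq_some hX hXind hh]
    ring
  simp only [hsome, applyMark, mul_assoc (ENNReal.ofReal h * Q), ENNReal.tsum_mul_left] at hone ⊢
  set P0 := μ {ω | sliceMark p Fp Fm X h i z ω = none} with hP0
  -- `P0` includes the slices with several relevant points, in which the chain stays put. Total
  -- probability, `hone`, then absorbs the term with `totalRate`.
  calc P0 * weight w z + ENNReal.ofReal h * Q *
        ∑' m, ENNReal.ofReal (rate p Fp Fm m z) * weight w (transition m z)
      ≤ P0 * weight w z + ENNReal.ofReal h * Q * ((totalRate p Fp Fm z + c) * weight w z) := by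
        gcongr
        exact tsum_rate_mul_weight_le hp hF hw hpw hz
    _ = (P0 + ENNReal.ofReal h * Q * totalRate p Fp Fm z) * weight w z
        + ENNReal.ofReal h * Q * c * weight w z := by ring
    _ ≤ 1 * weight w z + ENNReal.ofReal h * 1 * c * weight w z := by
        gcongr
        · exact hone.le
        · exact prob_le_one
    _ = _ := by ring

/-- One step of the discretized dynamics, in expectation. -/
lemma lintegral_history_succ_le (hh : 0 ≤ h) (z : V → ℕ) (j : ℕ)
    (f : List (Option (Mark V)) → ℝ≥0∞) {κ : ℝ≥0∞}
    (hf : ∀ l, ∑' o, μ {ω | sliceMark p Fp Fm X h j (confOf z l) ω = o} * f (o :: l)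
      ≤ κ * f l) :
    ∫⁻ ω, f (history p Fp Fm X h z ω (j + 1)) ∂μ ≤ κ * ∫⁻ ω, f (history p Fp Fm X h z ω j) ∂μ := by
  have hset : ∀ q : List (Option (Mark V)) × Option (Mark V),
      {ω | (history p Fp Fm X h z ω j,
        sliceMark p Fp Fm X h j (confOf z (history p Fp Fm X h z ω j)) ω) = q} =
      {ω | history p Fp Fm X h z ω j = q.1} ∩
        {ω | sliceMark p Fp Fm X h j (confOf z q.1) ω = q.2} := by
    rintro ⟨l, o⟩
    ext ω
    simp only [Set.mem_ofPred_eq, Set.mem_inter_iff, Prod.mk.injEq]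
    constructor
    · rintro ⟨h1, h2⟩
      exact ⟨h1, h1 ▸ h2⟩
    · rintro ⟨h1, h2⟩
      exact ⟨h1, h1 ▸ h2⟩
  have hY := measurableSet_history (p := p) (Fp := Fp) (Fm := Fm) (h := h) hX z j
  rw [(lintegral_comp_countable hY f).2]
  have hY' : ∀ q : List (Option (Mark V)) × Option (Mark V), MeasurableSet
      {ω | (history p Fp Fm X h z ω j,
        sliceMark p Fp Fm X h j (confOf z (history p Fp Fm X h z ω j)) ω) = q} := fun q => by
    rw [hset]
    exact (hY _).inter (measurableSet_sliceMark' hX _ _ _)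
  have hint := (lintegral_comp_countable (μ := μ) hY' fun q => f (q.2 :: q.1)).2
  simp only [hset] at hint
  simp only [history]
  -- Conditioning on the past is a sum over its countably many values.
  rw [hint, ENNReal.tsum_prod', ← ENNReal.tsum_mul_left]
  refine ENNReal.tsum_le_tsum fun l => ?_
  have hl : ∀ o, μ ({ω | history p Fp Fm X h z ω j = l} ∩
      {ω | sliceMark p Fp Fm X h j (confOf z l) ω = o}) =
      μ {ω | history p Fp Fm X h z ω j = l} *
        μ {ω | sliceMark p Fp Fm X h j (confOf z l) ω = o} := fun o =>
    measure_history_inter hX hXind hh z j l (fun m _ => rate p Fp Fm m (confOf z l))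
      (measurableSet_sliceMark (fun _ => rfl) o fun _ => rfl)
  simp only [hl, mul_assoc, ENNReal.tsum_mul_left]
  calc _ ≤ μ {ω | history p Fp Fm X h z ω j = l} * (κ * f l) := by
        gcongr
        exact hf l
    _ = _ := by ring

lemma lintegral_history_le (hh : 0 ≤ h) (z : V → ℕ) (f : List (Option (Mark V)) → ℝ≥0∞)
    {κ : ℝ≥0∞} (hf : ∀ j l, ∑' o, μ {ω | sliceMark p Fp Fm X h j (confOf z l) ω = o} * f (o :: l)
      ≤ κ * f l) (j : ℕ) :
    ∫⁻ ω, f (history p Fp Fm X h z ω j) ∂μ ≤ κ ^ j * f [] := by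
  induction j with
  | zero => simp [history]
  | succ j ih =>
    refine (lintegral_history_succ_le hX hXind hh z j f (hf j)).trans ?_
    rw [pow_succ', mul_assoc]
    gcongr

lemma lintegral_weight_history_le (hh : 0 ≤ h) (hp : IsTransitionKernel p)
    (hF : IsReactionPair Fp Fm) {w : V → ℝ≥0∞} (hw : ∀ x, w x ≠ ∞) {c : ℝ≥0∞}
    (hpw : ∀ x, ∑' y, ENNReal.ofReal (p x y) * w y ≤ c * w x) {z : V → ℕ}
    (hz : (Function.support z).Finite) (j : ℕ) :
    ∫⁻ ω, weight w (confOf z (history p Fp Fm X h z ω j)) ∂μ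
      ≤ (1 + ENNReal.ofReal h * c) ^ j * weight w z :=
  lintegral_history_le hX hXind hh z (fun l => weight w (confOf z l))
    (fun j l => tsum_measure_sliceMark_mul_weight_le hX hXind hh hp hF hw hpw
      (finite_support_confOf hz l) j) j

/-- The maximal inequality for the discretized dynamics. -/
lemma measure_exists_lt_weight_history_le (hh : 0 ≤ h) (hp : IsTransitionKernel p)
    (hF : IsReactionPair Fp Fm) {w : V → ℝ≥0∞} (hw : ∀ x, w x ≠ ∞) {c : ℝ≥0∞}
    (hpw : ∀ x, ∑' y, ENNReal.ofReal (p x y) * w y ≤ c * w x) {z : V → ℕ}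
    (hz : (Function.support z).Finite) {A : ℝ≥0∞} (hA : A ≠ 0) (hA' : A ≠ ∞) (j : ℕ) :
    μ {ω | ∃ i ≤ j, A < weight w (confOf z (history p Fp Fm X h z ω i))}
      ≤ (1 + ENNReal.ofReal h * c) ^ j * weight w z / A := by
  -- The one-step bound survives stopping: a frozen value is unchanged, and the factor is at least
  -- `1`.
  have hstep : ∀ j l, ∑' o, μ {ω | sliceMark p Fp Fm X h j (confOf z l) ω = o} *
      stopped (weight w) A z (o :: l) ≤
      (1 + ENNReal.ofReal h * c) * stopped (weight w) A z l := by
    intro j l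
    simp only [stopped]
    split_ifs with hl
    · rw [ENNReal.tsum_mul_right]
      have hone : ∑' o, μ {ω | sliceMark p Fp Fm X h j (confOf z l) ω = o} = 1 := by
        have := (lintegral_comp_countable (μ := μ) (measurableSet_sliceMark' (p := p) (Fp := Fp)
          (Fm := Fm) (h := h) hX j (confOf z l)) fun _ => 1).2
        simpa using this.symm
      rw [hone]
      gcongr
      exact le_self_add
    · rw [stopped_eq hl]
      exact tsum_measure_sliceMark_mul_weight_le hX hXind hh hp hF hw hpw
        (finite_support_confOf hz l) j
  have hY := measurableSet_history (p := p) (Fp := Fp) (Fm := Fm) (h := h) hX z j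
  refine (measure_mono fun ω hω => ?_).trans ((meas_ge_le_lintegral_div
    (lintegral_comp_countable (μ := μ) hY (stopped (weight w) A z)).1.aemeasurable hA hA').trans ?_)
  · obtain ⟨i, hij, hi⟩ := hω
    exact (lt_stopped_history hij hi).le
  · gcongr
    exact lintegral_history_le hX hXind hh z _ hstep j

omit [Countable V] in
lemma measure_one_le_and_one_le (hh : 0 ≤ h) (i : ℕ) {m m' : Mark V} (hne : m' ≠ m) (c c' : ℝ) :
    μ {ω | 1 ≤ sliceCount X h i m c ω ∧ 1 ≤ sliceCount X h i m' c' ω}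
      ≤ (ENNReal.ofReal h * ENNReal.ofReal c) * (ENNReal.ofReal h * ENNReal.ofReal c') := by
  classical
  set g : Mark V → ℕ → ℝ := fun m'' _ => if m'' = m then c else c' with hg
  have hgm : g m i = c := if_pos rfl
  have hgm' : g m' i = c' := if_neg hne
  have h1 := measurableSet_countAlgebra (X := X) (h := h) g (Set.mem_singleton (m, i)) (Set.Ici 1)
  have h2 := measurableSet_countAlgebra (X := X) (h := h) g (Set.mem_singleton (m', i)) (Set.Ici 1)
  rw [hgm] at h1
  rw [hgm'] at h2
  have hind := (Indep_iff _ _ μ).1 (indep_countAlgebra hX hXind hh g (S := {(m, i)})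
    (T := {(m', i)}) (by
      rw [Set.disjoint_singleton]
      exact fun he => hne (congrArg Prod.fst he).symm)) _ _ h1 h2
  refine hind.le.trans ?_
  gcongr
  · exact measure_one_le_count (measurable_sliceCount hX i m c) (law_sliceCount hX hh i m c)
  · exact measure_one_le_count (measurable_sliceCount hX i m' c') (law_sliceCount hX hh i m' c')

/-- A union bound over pairs of points in one slice. Each pair costs a factor `h` per point, and the
slice is independent of the history. -/
lemma measure_history_inter_bad_le (hh : 0 ≤ h) (z : V → ℕ) (j : ℕ) (l : List (Option (Mark V)))
    {D : ℝ≥0∞} (hD : ∑' m, ENNReal.ofReal (rate p Fp Fm m (confOf z l)) *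
          (∑' m', ENNReal.ofReal (max (rate p Fp Fm m' (confOf z l))
            (rate p Fp Fm m' (transition m (confOf z l))))) +
        ∑' m, (if 0 < rate p Fp Fm m (confOf z l) then
          ENNReal.ofReal (max (rate p Fp Fm m (confOf z l))
            (rate p Fp Fm m (transition m (confOf z l)))) else 0) ^ 2 ≤ D) :
    μ ({ω | history p Fp Fm X h z ω j = l} ∩ {ω | Bad p Fp Fm X h j (confOf z l) ω})
      ≤ μ {ω | history p Fp Fm X h z ω j = l} * (ENNReal.ofReal h ^ 2 * D) := by
  classical
  set y := confOf z l with hy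
  set H := {ω | history p Fp Fm X h z ω j = l} with hH
  set ρ : Mark V → Mark V → ℝ := fun m m' =>
    max (rate p Fp Fm m' y) (rate p Fp Fm m' (transition m y)) with hρ
  have hsub : H ∩ {ω | Bad p Fp Fm X h j y ω} ⊆
      (⋃ m, ⋃ m', H ∩ {ω | m' ≠ m ∧ 1 ≤ sliceCount X h j m (rate p Fp Fm m y) ω ∧
        1 ≤ sliceCount X h j m' (ρ m m') ω}) ∪
      ⋃ m, H ∩ {ω | 0 < rate p Fp Fm m y ∧ 2 ≤ sliceCount X h j m (ρ m m) ω} := by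
    rintro ω ⟨hω, m, ⟨m', hm'⟩ | hm⟩
    · exact .inl (Set.mem_iUnion.2 ⟨m, Set.mem_iUnion.2 ⟨m', hω, hm'⟩⟩)
    · exact .inr (Set.mem_iUnion.2 ⟨m, hω, hm⟩)
  have hpair : ∀ m m', μ (H ∩ {ω | m' ≠ m ∧ 1 ≤ sliceCount X h j m (rate p Fp Fm m y) ω ∧
      1 ≤ sliceCount X h j m' (ρ m m') ω}) ≤ μ H * (ENNReal.ofReal h ^ 2 *
        (ENNReal.ofReal (rate p Fp Fm m y) * ENNReal.ofReal (ρ m m'))) := by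
    intro m m'
    rcases eq_or_ne m' m with rfl | hne
    · simp
    · set g : Mark V → ℕ → ℝ := fun m'' _ => if m'' = m then rate p Fp Fm m y else ρ m m' with hg
      have hgm : g m j = rate p Fp Fm m y := if_pos rfl
      have hgm' : g m' j = ρ m m' := if_neg hne
      have h1 := measurableSet_countAlgebra (X := X) (h := h) g
        (show (m, j) ∈ {q : Mark V × ℕ | q.2 = j} from rfl) (Set.Ici 1)
      have h2 := measurableSet_countAlgebra (X := X) (h := h) g
        (show (m', j) ∈ {q : Mark V × ℕ | q.2 = j} from rfl) (Set.Ici 1)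
      rw [hgm] at h1
      rw [hgm'] at h2
      have hsplit := measure_history_inter (p := p) (Fp := Fp) (Fm := Fm) hX hXind hh z j l g
        (h1.inter h2)
      have hset : {ω | m' ≠ m ∧ 1 ≤ sliceCount X h j m (rate p Fp Fm m y) ω ∧
          1 ≤ sliceCount X h j m' (ρ m m') ω} =
          {ω | sliceCount X h j m (rate p Fp Fm m y) ω ∈ Set.Ici 1} ∩
            {ω | sliceCount X h j m' (ρ m m') ω ∈ Set.Ici 1} := by
        ext ω
        simp [hne]
      rw [hset, hsplit]
      gcongr
      refine (measure_one_le_and_one_le hX hXind hh j hne _ _).trans (le_of_eq ?_)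
      ring
  have hdouble : ∀ m, μ (H ∩ {ω | 0 < rate p Fp Fm m y ∧ 2 ≤ sliceCount X h j m (ρ m m) ω}) ≤
      μ H * (ENNReal.ofReal h ^ 2 *
        (if 0 < rate p Fp Fm m y then ENNReal.ofReal (ρ m m) else 0) ^ 2) := by
    intro m
    split_ifs with hm
    · have h1 := measurableSet_countAlgebra (X := X) (h := h) (fun m _ => ρ m m)
        (show (m, j) ∈ {q : Mark V × ℕ | q.2 = j} from rfl) (Set.Ici 2)
      have hsplit := measure_history_inter (p := p) (Fp := Fp) (Fm := Fm) hX hXind hh z j l _ h1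
      simp only [hm, true_and]
      refine hsplit.le.trans ?_
      gcongr
      refine (measure_two_le_count (measurable_sliceCount hX j m (ρ m m))
        (law_sliceCount hX hh j m (ρ m m))).trans (le_of_eq ?_)
      rw [ENNReal.coe_mul, mul_pow]
      rfl
    · simp [hm]
  refine (measure_mono hsub).trans ((measure_union_le _ _).trans ?_)
  refine (add_le_add ((measure_iUnion_le _).trans (ENNReal.tsum_le_tsum fun m =>
    (measure_iUnion_le _).trans (ENNReal.tsum_le_tsum fun m' => hpair m m')))
    ((measure_iUnion_le _).trans (ENNReal.tsum_le_tsum hdouble))).trans ?_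
  simp only [ENNReal.tsum_mul_left, ← mul_add]
  gcongr

/-- Bad slices are unlikely. -/
lemma measure_exists_bad_le (hh : 0 ≤ h) (z : V → ℕ) (n K : ℕ) {D : ℝ≥0∞}
    (hD : ∀ y : V → ℕ, weight (fun _ => 1) y ≤ K →
      ∑' m, ENNReal.ofReal (rate p Fp Fm m y) *
          (∑' m', ENNReal.ofReal (max (rate p Fp Fm m' y) (rate p Fp Fm m' (transition m y)))) +
        ∑' m, (if 0 < rate p Fp Fm m y then
          ENNReal.ofReal (max (rate p Fp Fm m y) (rate p Fp Fm m (transition m y))) else 0) ^ 2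
        ≤ D) :
    μ {ω | ∃ i < n, Bad p Fp Fm X h i (confOf z (history p Fp Fm X h z ω i)) ω}
      ≤ μ {ω | ∃ i ≤ n, K < weight (fun _ => 1) (confOf z (history p Fp Fm X h z ω i))}
        + n * (ENNReal.ofReal h ^ 2 * D) := by
  -- Either the mass exceeds `K` at some time, or a bad slice is entered with mass at most `K`,
  -- where `D` applies.
  have hsub : {ω | ∃ i < n, Bad p Fp Fm X h i (confOf z (history p Fp Fm X h z ω i)) ω} ⊆
      {ω | ∃ i ≤ n, K < weight (fun _ => 1) (confOf z (history p Fp Fm X h z ω i))} ∪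
      ⋃ i ∈ Finset.range n, ⋃ l, {ω | weight (fun _ => 1) (confOf z l) ≤ K ∧
        history p Fp Fm X h z ω i = l ∧ Bad p Fp Fm X h i (confOf z l) ω} := by
    rintro ω ⟨i, hi, hbad⟩
    rcases lt_or_ge (K : ℝ≥0∞) (weight (fun _ => 1) (confOf z (history p Fp Fm X h z ω i)))
      with hK | hK
    · exact .inl ⟨i, hi.le, hK⟩
    · exact .inr (Set.mem_biUnion (Finset.mem_coe.2 (Finset.mem_range.2 hi))
        (Set.mem_iUnion.2 ⟨_, hK, rfl, hbad⟩))
  refine (measure_mono hsub).trans ((measure_union_le _ _).trans ?_)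
  gcongr
  refine (measure_biUnion_finset_le _ _).trans ?_
  refine (Finset.sum_le_card_nsmul _ _ (ENNReal.ofReal h ^ 2 * D) fun i _ => ?_).trans_eq (by simp)
  have hone : ∑' l, μ {ω | history p Fp Fm X h z ω i = l} = 1 := by
    have := (lintegral_comp_countable (μ := μ)
      (measurableSet_history (p := p) (Fp := Fp) (Fm := Fm) (h := h) hX z i) fun _ => 1).2
    simpa using this.symm
  refine (measure_iUnion_le _).trans ((ENNReal.tsum_le_tsum (g := fun l =>
    μ {ω | history p Fp Fm X h z ω i = l} * (ENNReal.ofReal h ^ 2 * D)) fun l => ?_).trans ?_)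
  · by_cases hl : weight (fun _ => 1) (confOf z l) ≤ K
    · refine le_trans (measure_mono ?_) (measure_history_inter_bad_le hX hXind hh z i l (hD _ hl))
      exact fun ω hω => hω.2
    · simp [hl]
  · rw [ENNReal.tsum_mul_right, hone, one_mul]

end ChainEstimates

end ReactionDiffusion

namespace ReactionDiffusion

/-! ### Vanishing mesh: from the chain to the flow on finite configurations. -/

section FiniteFlow

lemma one_add_pow_le_exp {T c : ℝ} (hT : 0 ≤ T) (hc : 0 ≤ c) (n : ℕ) :
    (1 + ENNReal.ofReal (T / (n + 1 : ℕ)) * ENNReal.ofReal c) ^ (n + 1)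
      ≤ ENNReal.ofReal (Real.exp (c * T)) := by
  rw [← ENNReal.ofReal_mul (by positivity), ← ENNReal.ofReal_one,
    ← ENNReal.ofReal_add zero_le_one (by positivity), ← ENNReal.ofReal_pow (by positivity)]
  refine ENNReal.ofReal_le_ofReal ?_
  have h1 : 1 + T / (n + 1 : ℕ) * c ≤ Real.exp (T / (n + 1 : ℕ) * c) := by
    rw [add_comm]
    exact Real.add_one_le_exp _
  refine (pow_le_pow_left₀ (by positivity) h1 _).trans_eq ?_
  rw [← Real.exp_nat_mul]
  congr 1
  have : ((n + 1 : ℕ) : ℝ) ≠ 0 := by positivity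
  field_simp

lemma tendsto_mul_sq_mesh {T : ℝ} (hT : 0 ≤ T) {D : ℝ≥0∞} (hD : D ≠ ∞) :
    Tendsto (fun n : ℕ => ((n + 1 : ℕ) : ℝ≥0∞) * (ENNReal.ofReal (T / (n + 1 : ℕ)) ^ 2 * D))
      atTop (𝓝 0) := by
  have h1 : Tendsto (fun n : ℕ => T ^ 2 / ((n + 1 : ℕ) : ℝ)) atTop (𝓝 0) :=
    (tendsto_const_div_atTop_nhds_zero_nat (T ^ 2)).comp (tendsto_add_atTop_nat 1)
  have h2 := ENNReal.Tendsto.mul_const (ENNReal.tendsto_ofReal h1) (.inr hD)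
  rw [ENNReal.ofReal_zero, zero_mul] at h2
  refine h2.congr fun n => ?_
  rw [← mul_assoc, ← ENNReal.ofReal_pow (by positivity), ← ENNReal.ofReal_natCast,
    ← ENNReal.ofReal_mul (by positivity)]
  congr 2
  have : ((n + 1 : ℕ) : ℝ) ≠ 0 := by positivity
  field_simp

/-- Borel–Cantelli along a subsequence with summable probabilities. -/
lemma exists_seq_ae_eventually_notMem {Ω : Type*} [MeasurableSpace Ω] {μ : Measure Ω}
    {s : ℕ → Set Ω} (hs : Tendsto (fun n => μ (s n)) atTop (𝓝 0)) :
    ∃ ns : ℕ → ℕ, ∀ᵐ ω ∂μ, ∀ᶠ k in atTop, ω ∉ s (ns k) := by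
  have hex : ∀ k : ℕ, ∃ n, μ (s n) ≤ 2⁻¹ ^ k := fun k =>
    ((ENNReal.tendsto_nhds_zero.1 hs) (2⁻¹ ^ k)
      (ENNReal.pow_pos (ENNReal.inv_pos.2 ENNReal.ofNat_ne_top) k)).exists
  choose ns hns using hex
  refine ⟨ns, ae_eventually_notMem (ne_top_of_le_ne_top ?_ (ENNReal.tsum_le_tsum hns))⟩
  rw [ENNReal.tsum_geometric, ENNReal.one_sub_inv_two, inv_inv]
  exact ENNReal.ofNat_ne_top

/-- A function that agrees with measurable functions outside of events of vanishing probability. -/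
lemma aemeasurable_and_lintegral_le_of_tendsto {Ω : Type*} [MeasurableSpace Ω] {μ : Measure Ω}
    {s : ℕ → Set Ω} (hs : Tendsto (fun n => μ (s n)) atTop (𝓝 0)) {f : Ω → ℝ≥0∞}
    {g : ℕ → Ω → ℝ≥0∞} (hg : ∀ n, Measurable (g n)) (hfg : ∀ n, ∀ ω ∉ s n, g n ω = f ω) :
    AEMeasurable f μ ∧ ∀ B : ℝ≥0∞, (∀ n, ∫⁻ ω, g n ω ∂μ ≤ B) → ∫⁻ ω, f ω ∂μ ≤ B := by
  obtain ⟨ns, hns⟩ := exists_seq_ae_eventually_notMem hs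
  have hlim : ∀ᵐ ω ∂μ, Tendsto (fun k => g (ns k) ω) atTop (𝓝 (f ω)) := by
    filter_upwards [hns] with ω hω
    refine tendsto_const_nhds.congr' ?_
    filter_upwards [hω] with k hk
    exact (hfg _ ω hk).symm
  refine ⟨aemeasurable_of_tendsto_metrizable_ae' (fun k => (hg (ns k)).aemeasurable) hlim,
    fun B hB => ?_⟩
  -- Fatou's lemma along the subsequence.
  calc ∫⁻ ω, f ω ∂μ = ∫⁻ ω, liminf (fun k => g (ns k) ω) atTop ∂μ := by
        refine lintegral_congr_ae ?_
        filter_upwards [hlim] with ω hω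
        exact hω.liminf_eq.symm
    _ ≤ liminf (fun k => ∫⁻ ω, g (ns k) ω ∂μ) atTop := lintegral_liminf_le fun k => hg (ns k)
    _ ≤ liminf (fun _ => B) atTop := liminf_le_liminf (.of_forall fun k => hB (ns k))
    _ = B := liminf_const B

variable {V Ω : Type*} {p : V → V → ℝ} {Fp Fm : ℕ → ℝ} {X : Mark V → Ω → Set (ℝ × ℝ)}

/-- The event that one of the slices of length `T / (n + 1)` is bad. -/
def badEvent (p : V → V → ℝ) (Fp Fm : ℕ → ℝ) (X : Mark V → Ω → Set (ℝ × ℝ)) (z : V → ℕ) (T : ℝ)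
    (n : ℕ) : Set Ω :=
  {ω | ∃ i < n + 1, Bad p Fp Fm X (T / (n + 1 : ℕ)) i
    (confOf z (history p Fp Fm X (T / (n + 1 : ℕ)) z ω i)) ω}

lemma exists_evolves_of_notMem_badEvent {z : V → ℕ} {T : ℝ} (hT : 0 ≤ T) {n : ℕ} {ω : Ω}
    (hω : ω ∉ badEvent p Fp Fm X z T n) :
    (∀ t ∈ Set.Icc 0 T, ∃ j ≤ n + 1, ∃ k, Evolves p Fp Fm (fun m => X m ω) 0 z t
      (confOf z (history p Fp Fm X (T / (n + 1 : ℕ)) z ω j)) k) ∧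
    (∀ j ≤ n + 1, ∃ t ∈ Set.Icc 0 T, ∃ k, Evolves p Fp Fm (fun m => X m ω) 0 z t
      (confOf z (history p Fp Fm X (T / (n + 1 : ℕ)) z ω j)) k) ∧
    ∃ k, Evolves p Fp Fm (fun m => X m ω) 0 z T
      (confOf z (history p Fp Fm X (T / (n + 1 : ℕ)) z ω (n + 1))) k := by
  have hbad : ∀ i < n + 1, ¬ Bad p Fp Fm X (T / (n + 1 : ℕ)) i
      (confOf z (history p Fp Fm X (T / (n + 1 : ℕ)) z ω i)) ω := fun i hi hb => hω ⟨i, hi, hb⟩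
  have hh : 0 ≤ T / (n + 1 : ℕ) := by positivity
  have hTn : ((n + 1 : ℕ) : ℝ) * (T / (n + 1 : ℕ)) = T := by
    have : ((n + 1 : ℕ) : ℝ) ≠ 0 := by positivity
    field_simp
  have hev := exists_evolves_history hh (n + 1) hbad
  rw [hTn] at hev
  refine ⟨fun t ht => hev.2 t ht.1 ht.2, fun j hj => ⟨j * (T / (n + 1 : ℕ)), ⟨by positivity, ?_⟩,
    (exists_evolves_history hh j fun i hi => hbad i (hi.trans_le hj)).1⟩, hev.1⟩
  calc (j : ℝ) * (T / (n + 1 : ℕ)) ≤ ((n + 1 : ℕ) : ℝ) * (T / (n + 1 : ℕ)) := by gcongr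
    _ = T := hTn

/-- Off the bad event, chain and flow visit the same configurations during `[0, T]`. This replaces
an uncountable supremum by a finite one, which makes it accessible to measurability arguments. -/
lemma iSup_flow_eq_of_notMem_badEvent {z : V → ℕ} {T : ℝ} (hT : 0 ≤ T) {n : ℕ} {ω : Ω}
    (hω : ω ∉ badEvent p Fp Fm X z T n) (f : (V → ℕ) → ℝ≥0∞) :
    ⨆ j ∈ Set.Iic (n + 1), f (confOf z (history p Fp Fm X (T / (n + 1 : ℕ)) z ω j))
      = ⨆ t ∈ Set.Icc 0 T, f (flow p Fp Fm (fun m => X m ω) 0 t z) := by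
  obtain ⟨h1, h2, -⟩ := exists_evolves_of_notMem_badEvent hT hω
  refine le_antisymm (iSup₂_le fun j hj => ?_) (iSup₂_le fun t ht => ?_)
  · obtain ⟨t, ht, k, hk⟩ := h2 j hj
    rw [← hk.flow_eq]
    exact le_iSup₂_of_le t ht le_rfl
  · obtain ⟨j, hj, k, hk⟩ := h1 t ht
    rw [hk.flow_eq]
    exact le_iSup₂_of_le (f := fun j (_ : j ∈ Set.Iic (n + 1)) =>
      f (confOf z (history p Fp Fm X (T / (n + 1 : ℕ)) z ω j))) j hj le_rfl

variable [Countable V] [MeasurableSpace Ω] {μ : Measure Ω} [IsProbabilityMeasure μ]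
  (hX : ∀ m, IsPoissonPointProcess (X m)
    ((volume : Measure (ℝ × ℝ)).restrict (Set.Ioi 0 ×ˢ Set.Ioi 0)) μ)
  (hXind : iIndep (fun m => countSigma (X m)) μ) (hp : IsTransitionKernel p)
  (hF : IsReactionPair Fp Fm)

include hX hXind hp hF

/-- The mass cap is fixed first, by the maximal inequality with weight `1` and uniformly in the
mesh. With the cap fixed, the bad slices have total probability O(T² / n). -/
lemma tendsto_measure_badEvent {z : V → ℕ} (hz : (Function.support z).Finite) {T : ℝ}
    (hT : 0 ≤ T) : Tendsto (fun n => μ (badEvent p Fp Fm X z T n)) atTop (𝓝 0) := by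
  have h1w : ∀ x : V, (fun _ : V => (1 : ℝ≥0∞)) x ≠ ∞ := fun _ => ENNReal.one_ne_top
  have hpw : ∀ x, ∑' y, ENNReal.ofReal (p x y) * (fun _ : V => (1 : ℝ≥0∞)) y
      ≤ ENNReal.ofReal 1 * (fun _ : V => (1 : ℝ≥0∞)) x := fun x => by
    simp [hp.tsum_ofReal]
  set E : ℝ≥0∞ := ENNReal.ofReal (Real.exp (1 * T)) * weight (fun _ => 1) z with hE
  have hEtop : E ≠ ∞ := ENNReal.mul_ne_top ENNReal.ofReal_ne_top (weight_ne_top h1w hz)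
  have hK : Tendsto (fun K : ℕ => E / ((K + 1 : ℕ) : ℝ≥0∞)) atTop (𝓝 0) := by
    have := (ENNReal.Tendsto.const_mul ENNReal.tendsto_inv_nat_nhds_zero (.inr hEtop)).comp
      (tendsto_add_atTop_nat 1)
    rw [mul_zero] at this
    exact this
  rw [ENNReal.tendsto_nhds_zero]
  intro ε hε
  have hε2 : ε / 2 > 0 := ENNReal.half_pos hε.ne'
  obtain ⟨K, hK⟩ := ((ENNReal.tendsto_nhds_zero.1 hK) (ε / 2) hε2).exists
  obtain ⟨D, hDtop, hD⟩ := exists_pair_rate_bound hp hF (K + 1)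
  filter_upwards [(ENNReal.tendsto_nhds_zero.1 (tendsto_mul_sq_mesh hT hDtop)) (ε / 2) hε2]
    with n hn
  have hh : 0 ≤ T / (n + 1 : ℕ) := by positivity
  refine (measure_exists_bad_le hX hXind hh z (n + 1) (K + 1) hD).trans ?_
  rw [← ENNReal.add_halves ε]
  refine add_le_add (le_trans ?_ hK) hn
  refine (measure_exists_lt_weight_history_le hX hXind hh hp hF h1w hpw hz (by simp)
    (ENNReal.natCast_ne_top _) (n + 1)).trans ?_
  gcongr
  exact mul_le_mul_left (one_add_pow_le_exp hT zero_le_one n) _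

/-- Almost surely there is no explosion. -/
lemma ae_exists_evolves {z : V → ℕ} (hz : (Function.support z).Finite) :
    ∀ᵐ ω ∂μ, ∀ t, 0 ≤ t → ∃ ζ k, Evolves p Fp Fm (fun m => X m ω) 0 z t ζ k := by
  have hN : ∀ N : ℕ, ∀ᵐ ω ∂μ, ∀ t ∈ Set.Icc 0 (N : ℝ),
      ∃ ζ k, Evolves p Fp Fm (fun m => X m ω) 0 z t ζ k := by
    intro N
    obtain ⟨ns, hns⟩ := exists_seq_ae_eventually_notMem
      (tendsto_measure_badEvent hX hXind hp hF hz N.cast_nonneg)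
    filter_upwards [hns] with ω hω t ht
    obtain ⟨k, hk⟩ := hω.exists
    obtain ⟨j, -, n, hn⟩ := (exists_evolves_of_notMem_badEvent N.cast_nonneg hk).1 t ht
    exact ⟨_, n, hn⟩
  filter_upwards [ae_all_iff.2 hN] with ω hω t ht
  obtain ⟨N, hN⟩ := exists_nat_ge t
  exact hω N t ⟨ht, hN⟩

variable {w : V → ℝ≥0∞} (hw : ∀ x, w x ≠ ∞) {c : ℝ} (hc : 0 ≤ c)
  (hpw : ∀ x, ∑' y, ENNReal.ofReal (p x y) * w y ≤ ENNReal.ofReal c * w x)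

lemma aemeasurable_iSup_weight_flow {z : V → ℕ} (hz : (Function.support z).Finite) {T : ℝ}
    (hT : 0 ≤ T) :
    AEMeasurable (fun ω => ⨆ t ∈ Set.Icc 0 T,
      weight w (flow p Fp Fm (fun m => X m ω) 0 t z)) μ := by
  refine (aemeasurable_and_lintegral_le_of_tendsto (tendsto_measure_badEvent hX hXind hp hF hz hT)
    (fun n => ?_) fun n ω hω => iSup_flow_eq_of_notMem_badEvent hT hω (weight w)).1
  exact .biSup _ (Set.to_countable _) fun j _ => (lintegral_comp_countable (μ := μ)
    (measurableSet_history hX z j) fun l => weight w (confOf z l)).1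

include hw hc hpw

/-- The maximal inequality for the flow on finite configurations. -/
lemma measure_lt_iSup_weight_flow_le {z : V → ℕ} (hz : (Function.support z).Finite) {T : ℝ}
    (hT : 0 ≤ T) {A : ℝ≥0∞} (hA : A ≠ 0) (hA' : A ≠ ∞) :
    μ {ω | A < ⨆ t ∈ Set.Icc 0 T, weight w (flow p Fp Fm (fun m => X m ω) 0 t z)}
      ≤ ENNReal.ofReal (Real.exp (c * T)) * weight w z / A := by
  have hlim := (tendsto_measure_badEvent (μ := μ) hX hXind hp hF hz hT).add_const
    (ENNReal.ofReal (Real.exp (c * T)) * weight w z / A)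
  rw [zero_add] at hlim
  refine ge_of_tendsto' hlim fun n => ?_
  have hh : 0 ≤ T / (n + 1 : ℕ) := by positivity
  refine (measure_mono (t := badEvent p Fp Fm X z T n ∪ {ω | ∃ i ≤ n + 1,
    A < weight w (confOf z (history p Fp Fm X (T / (n + 1 : ℕ)) z ω i))}) fun ω hω => ?_).trans
    ((measure_union_le _ _).trans ?_)
  · by_cases hbad : ω ∈ badEvent p Fp Fm X z T n
    · exact .inl hbad
    · rw [Set.mem_ofPred_eq, ← iSup_flow_eq_of_notMem_badEvent hT hbad, lt_iSup_iff] at hω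
      obtain ⟨i, hi⟩ := hω
      obtain ⟨hi1, hi2⟩ := lt_iSup_iff.1 hi
      exact .inr ⟨i, hi1, hi2⟩
  · gcongr
    refine (measure_exists_lt_weight_history_le hX hXind hh hp hF hw hpw hz hA hA' (n + 1)).trans ?_
    gcongr
    exact one_add_pow_le_exp hT hc n

/-- The expected weight of the flow on finite configurations. -/
lemma aemeasurable_and_lintegral_weight_flow_le {z : V → ℕ} (hz : (Function.support z).Finite)
    {T : ℝ} (hT : 0 ≤ T) :
    AEMeasurable (fun ω => weight w (flow p Fp Fm (fun m => X m ω) 0 T z)) μ ∧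
      ∫⁻ ω, weight w (flow p Fp Fm (fun m => X m ω) 0 T z) ∂μ
        ≤ ENNReal.ofReal (Real.exp (c * T)) * weight w z := by
  have key := aemeasurable_and_lintegral_le_of_tendsto
    (tendsto_measure_badEvent (μ := μ) hX hXind hp hF hz hT)
    (f := fun ω => weight w (flow p Fp Fm (fun m => X m ω) 0 T z))
    (g := fun n ω => weight w (confOf z (history p Fp Fm X (T / (n + 1 : ℕ)) z ω (n + 1))))
    (fun n => (lintegral_comp_countable (μ := μ)
      (measurableSet_history hX z (n + 1)) fun l => weight w (confOf z l)).1)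
    fun n ω hω => by
      obtain ⟨k, hk⟩ := (exists_evolves_of_notMem_badEvent hT hω).2.2
      rw [hk.flow_eq]
  refine ⟨key.1, key.2 _ fun n => ?_⟩
  refine (lintegral_weight_history_le hX hXind (by positivity) hp hF hw hpw hz (n + 1)).trans ?_
  gcongr
  exact one_add_pow_le_exp hT hc n

end FiniteFlow

/-! ### No two marks fire at the same time. -/

section NoSimultaneous

variable {V Ω : Type*} {X : Mark V → Ω → Set (ℝ × ℝ)}

lemma exists_slice {h r : ℝ} (hr : 0 < r) {n : ℕ} (hrn : r ≤ n * h) :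
    ∃ i < n, i * h < r ∧ r ≤ (i + 1) * h := by
  induction n with
  | zero =>
    rw [Nat.cast_zero, zero_mul] at hrn
    exact absurd hr hrn.not_gt
  | succ n ih =>
    rcases le_or_gt r (n * h) with hle | hlt
    · obtain ⟨i, hi, h1⟩ := ih hle
      exact ⟨i, hi.trans n.lt_succ_self, h1⟩
    · exact ⟨n, n.lt_succ_self, hlt, by exact_mod_cast hrn⟩

variable [Countable V] [MeasurableSpace Ω] {μ : Measure Ω} [IsProbabilityMeasure μ]

/-- Almost surely no two marks have a point at the same time. -/
lemma ae_mark_eq_of_mem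
    (hX : ∀ m, IsPoissonPointProcess (X m)
      ((volume : Measure (ℝ × ℝ)).restrict (Set.Ioi 0 ×ˢ Set.Ioi 0)) μ)
    (hXind : iIndep (fun m => countSigma (X m)) μ) :
    ∀ᵐ ω ∂μ, ∀ m m' : Mark V, ∀ r u u' : ℝ, 0 < r → 0 < u → 0 < u' → (r, u) ∈ X m ω →
      (r, u') ∈ X m' ω → m = m' := by
  have hN : ∀ m m' : Mark V, m' ≠ m → ∀ N : ℕ, ∀ᵐ ω ∂μ, ¬ ∃ r u u' : ℝ, 0 < r ∧ r ≤ N ∧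
      0 < u ∧ u < N ∧ 0 < u' ∧ u' < N ∧ (r, u) ∈ X m ω ∧ (r, u') ∈ X m' ω := by
    intro m m' hne N
    rw [ae_iff]
    simp only [not_not]
    have hlim := tendsto_mul_sq_mesh (T := N) N.cast_nonneg
      (D := ENNReal.ofReal N ^ 2) (by finiteness)
    refine le_antisymm (ge_of_tendsto' hlim fun n => ?_) zero_le
    set h : ℝ := N / (n + 1 : ℕ) with hh
    have hpos : 0 ≤ h := by positivity
    have hNh : (N : ℝ) = (n + 1 : ℕ) * h := by
      have : ((n + 1 : ℕ) : ℝ) ≠ 0 := by positivity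
      rw [hh]
      field_simp
    -- Simultaneous points fall in a common slice, which has probability at most `(h * N) ^ 2`;
    -- summed over the `n + 1` slices this vanishes with the mesh.
    refine (measure_mono (t := ⋃ i ∈ Finset.range (n + 1),
      {ω | 1 ≤ sliceCount X h i m N ω ∧ 1 ≤ sliceCount X h i m' N ω}) ?_).trans ?_
    · rintro ω ⟨r, u, u', hr, hrN, hu, huN, hu', huN', hmem, hmem'⟩
      obtain ⟨i, hi, h1, h2⟩ := exists_slice hr (hrN.trans_eq hNh)
      exact Set.mem_biUnion (Finset.mem_coe.2 (Finset.mem_range.2 hi))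
        ⟨one_le_sliceCount hmem h1 h2 hu huN, one_le_sliceCount hmem' h1 h2 hu' huN'⟩
    · refine (measure_biUnion_finset_le _ _).trans ?_
      refine (Finset.sum_le_card_nsmul _ _ (ENNReal.ofReal h ^ 2 * ENNReal.ofReal N ^ 2)
        fun i _ => ?_).trans_eq (by simp)
      refine (measure_one_le_and_one_le hX hXind hpos i hne N N).trans_eq ?_
      ring
  have hall : ∀ᵐ ω ∂μ, ∀ m m' : Mark V, m' ≠ m → ∀ N : ℕ, ¬ ∃ r u u' : ℝ, 0 < r ∧ r ≤ N ∧
      0 < u ∧ u < N ∧ 0 < u' ∧ u' < N ∧ (r, u) ∈ X m ω ∧ (r, u') ∈ X m' ω := by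
    refine ae_all_iff.2 fun m => ae_all_iff.2 fun m' => ?_
    by_cases hne : m' ≠ m
    · filter_upwards [ae_all_iff.2 (hN m m' hne)] with ω hω _
      exact hω
    · exact .of_forall fun ω h => absurd h hne
  filter_upwards [hall] with ω hω m m' r u u' hr hu hu' hmem hmem'
  by_contra hne
  obtain ⟨N, hN⟩ := exists_nat_gt (max r (max u u'))
  simp only [max_lt_iff] at hN
  exact hω m m' (Ne.symm hne) N ⟨r, u, u', hr, hN.1.le, hu, hN.2.1, hu', hN.2.2, hmem, hmem'⟩

end NoSimultaneous

end ReactionDiffusion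

namespace ReactionDiffusion

/-! ### Passage to infinite configurations by monotone limits. -/

section Extension

variable {V : Type*}

/-- The localization function, with values in the extended nonnegative reals. -/
noncomputable def alphaWeight (α : V → ℝ) (x : V) : ℝ≥0∞ := ENNReal.ofReal (α x)

lemma alphaNorm_toRealConf {α : V → ℝ} (hα : ∀ x, 0 < α x) (z : V → ℕ) :
    alphaNorm α (toRealConf z) = weight (alphaWeight α) z := by
  refine tsum_congr fun x => ?_
  rw [toRealConf, Nat.abs_cast, ENNReal.ofReal_mul (hα x).le, ENNReal.ofReal_natCast, alphaWeight]

lemma finite_support_of_mem_finiteConf {z : V → ℕ} (hz : z ∈ finiteConf V) :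
    (Function.support z).Finite := by
  have hlim := (show Summable (toRealConf z) from hz).tendsto_cofinite_zero
  have hev : ∀ᶠ x in cofinite, toRealConf z x < 1 := hlim.eventually (gt_mem_nhds one_pos)
  refine (eventually_cofinite.1 hev).subset fun x hx => ?_
  have h1 : 1 ≤ z x := Nat.one_le_iff_ne_zero.2 hx
  have : (1 : ℝ) ≤ z x := by exact_mod_cast h1
  exact this.not_gt

lemma tsum_ofReal_mul_alphaWeight_le {p : V → V → ℝ} (hp : IsTransitionKernel p) {α : V → ℝ}
    (hα : IsLocalization p α) {C : ℝ} (hC : 0 < C) (hpα : ∀ x, ∑' y, p x y * α y ≤ C * α x)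
    (x : V) :
    ∑' y, ENNReal.ofReal (p x y) * alphaWeight α y ≤ ENNReal.ofReal C * alphaWeight α x := by
  have hle : ∀ y, p x y ≤ 1 := fun y => le_hasSum (hp.hasSum_one x) y fun z _ => hp.nonneg x z
  have hnn : ∀ y, 0 ≤ p x y * α y := fun y => mul_nonneg (hp.nonneg x y) (hα.pos y).le
  -- A real `tsum` without summability is `0` by convention, so `hpα` transfers to extended
  -- nonnegative reals only once the series is known to converge.
  have hsum : Summable fun y => p x y * α y := hα.summable.of_nonneg_of_le hnn fun y =>
    mul_le_of_le_one_left (hα.pos y).le (hle y)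
  simp only [alphaWeight, ← ENNReal.ofReal_mul (hp.nonneg x _), ← ENNReal.ofReal_mul hC.le]
  rw [← ENNReal.ofReal_tsum_of_nonneg hnn hsum]
  exact ENNReal.ofReal_le_ofReal (hpα x)

/-- Occupation numbers are integers, so a discrepancy at `x` costs at least `α x`. -/
lemma eventually_eq_of_tendsto_alphaNorm {α : V → ℝ} (hα : ∀ x, 0 < α x) {a : ℕ → V → ℕ}
    {b : V → ℕ}
    (h : Tendsto (fun n => alphaNorm α (toRealConf (a n) - toRealConf b)) atTop (𝓝 0)) (x : V) :
    ∀ᶠ n in atTop, a n x = b x := by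
  filter_upwards [h.eventually (gt_mem_nhds (ENNReal.ofReal_pos.2 (hα x)))] with n hn
  by_contra hne
  refine hn.not_ge (le_trans (ENNReal.ofReal_le_ofReal ?_) (ENNReal.le_tsum x))
  have h1 : (1 : ℝ) ≤ |(a n x : ℝ) - b x| := by
    have : (1 : ℤ) ≤ |(a n x : ℤ) - b x| := Int.one_le_abs (by omega)
    exact_mod_cast this
  exact le_mul_of_one_le_right (hα x).le h1

/-- Dominated convergence for configurations. -/
lemma tendsto_alphaNorm_sub {α : V → ℝ} (hα : ∀ x, 0 < α x) {a : ℕ → V → ℕ} {b : V → ℕ}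
    (hb : weight (alphaWeight α) b ≠ ∞) (hab : ∀ n, a n ≤ b)
    (hlim : ∀ x, ∀ᶠ n in atTop, a n x = b x) :
    Tendsto (fun n => alphaNorm α (toRealConf (a n) - toRealConf b)) atTop (𝓝 0) := by
  let _ : MeasurableSpace V := ⊤
  have : DiscreteMeasurableSpace V := ⟨fun _ => trivial⟩
  have hconv := tendsto_lintegral_of_dominated_convergence (μ := Measure.count)
    (F := fun n x => ENNReal.ofReal (α x * |(toRealConf (a n) - toRealConf b) x|))
    (f := fun _ => 0) (fun x => alphaWeight α x * b x) (fun n => .of_discrete)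
    (fun n => .of_forall fun x => ?_) ?_ (.of_forall fun x => ?_)
  · simp only [lintegral_count, tsum_zero] at hconv
    exact hconv
  · have h1 : (a n x : ℝ) ≤ b x := by exact_mod_cast hab n x
    have h2 : |(toRealConf (a n) - toRealConf b) x| ≤ b x := by
      simp only [Pi.sub_apply, toRealConf]
      rw [abs_of_nonpos (by linarith)]
      have : (0 : ℝ) ≤ a n x := Nat.cast_nonneg _
      linarith
    change _ ≤ ENNReal.ofReal (α x) * (b x : ℝ≥0∞)
    rw [← ENNReal.ofReal_natCast, ← ENNReal.ofReal_mul (hα x).le]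
    exact ENNReal.ofReal_le_ofReal (mul_le_mul_of_nonneg_left h2 (hα x).le)
  · rwa [lintegral_count]
  · refine tendsto_const_nhds.congr' ?_
    filter_upwards [hlim x] with n hn
    simp [toRealConf, hn]

lemma eventually_le_of_eventually_eq {a : ℕ → V → ℕ} {b z : V → ℕ}
    (hlim : ∀ x, ∀ᶠ n in atTop, a n x = b x) (hz : (Function.support z).Finite) (hzb : z ≤ b) :
    ∀ᶠ n in atTop, z ≤ a n := by
  filter_upwards [(eventually_all_finite hz).2 fun x _ => hlim x] with n hn x
  by_cases hx : x ∈ Function.support z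
  · rw [hn x hx]
    exact hzb x
  · rw [Function.notMem_support.1 hx]
    exact Nat.zero_le _

/-- A bounded increasing sequence of configurations is eventually constant at each site. -/
lemma eventually_eq_iSup {a : ℕ → V → ℕ} (ha : Monotone a) {x : V}
    (hb : BddAbove (Set.range fun n => a n x)) : ∀ᶠ n in atTop, a n x = ⨆ k, a k x := by
  obtain ⟨k, hk⟩ := Nat.sSup_mem (Set.range_nonempty fun n => a n x) hb
  filter_upwards [eventually_ge_atTop k] with n hn
  refine le_antisymm (le_ciSup hb n) ?_
  exact (show ⨆ k, a k x = a k x from hk.symm).le.trans (ha hn x)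

/-- The supremum of an unbounded family in `ℕ` is `0` by convention, so this bound is what makes
`limitFlow` a genuine limit. -/
lemma bddAbove_of_weight_le {w : V → ℝ≥0∞} (hw : ∀ x, w x ≠ 0) {a : ℕ → V → ℕ} {S : ℝ≥0∞}
    (hS : S ≠ ∞) (ha : ∀ n, weight w (a n) ≤ S) (x : V) : BddAbove (Set.range fun n => a n x) := by
  obtain ⟨N, hN⟩ := ENNReal.exists_nat_gt (ENNReal.div_ne_top hS (hw x))
  refine ⟨N, ?_⟩
  rintro _ ⟨n, rfl⟩
  have h1 : w x * a n x ≤ S := (ENNReal.le_tsum (f := fun x => w x * a n x) x).trans (ha n)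
  have h2 : (a n x : ℝ≥0∞) ≤ S / w x := by
    rw [ENNReal.le_div_iff_mul_le (.inl (hw x)) (.inr hS), mul_comm]
    exact h1
  exact_mod_cast (h2.trans_lt hN).le

/-- Monotone convergence for configurations. -/
lemma weight_iSup {w : V → ℝ≥0∞} {a : ℕ → V → ℕ} (ha : Monotone a)
    (hb : ∀ x, BddAbove (Set.range fun n => a n x)) :
    weight w (fun x => ⨆ n, a n x) = ⨆ n, weight w (a n) := by
  refine le_antisymm ?_ (iSup_le fun n => weight_mono w fun x => le_ciSup (hb x) n)
  rw [weight, ENNReal.tsum_eq_iSup_sum]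
  refine iSup_le fun s => ?_
  obtain ⟨n, hn⟩ := ((eventually_all_finset s).2 fun x _ => eventually_eq_iSup ha (hb x)).exists
  refine le_iSup_of_le n (le_trans (le_of_eq ?_) (ENNReal.sum_le_tsum s))
  exact Finset.sum_congr rfl fun x hx => by rw [hn x hx]

/-- For almost all realizations: evolutions from finite configurations exist for all times, and
different marks have no points at the same time. -/
structure Regular (p : V → V → ℝ) (Fp Fm : ℕ → ℝ) (X : Mark V → Set (ℝ × ℝ)) : Prop where
  exists_evolves : ∀ z : V → ℕ, (Function.support z).Finite → ∀ t, 0 ≤ t →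
    ∃ ζ k, Evolves p Fp Fm X 0 z t ζ k
  mark_eq : ∀ m m' : Mark V, ∀ r u u' : ℝ, 0 < r → 0 < u → 0 < u' → (r, u) ∈ X m →
    (r, u') ∈ X m' → m = m'

lemma Regular.flow_mono {p : V → V → ℝ} {Fp Fm : ℕ → ℝ} {X : Mark V → Set (ℝ × ℝ)}
    (h : Regular p Fp Fm X) (hp : IsTransitionKernel p) {z z' : V → ℕ}
    (hz : (Function.support z).Finite) (hz' : (Function.support z').Finite) (hle : z ≤ z') {t : ℝ}
    (ht : 0 ≤ t) : flow p Fp Fm X 0 t z ≤ flow p Fp Fm X 0 t z' := by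
  obtain ⟨ζ, k, hk⟩ := h.exists_evolves z hz t ht
  obtain ⟨ζ', k', hk'⟩ := h.exists_evolves z' hz' t ht
  rw [hk.flow_eq, hk'.flow_eq]
  exact Evolves.mono hp.nonneg h.mark_eq (k + k') le_rfl le_rfl hle hk hk'

/-- Finite configurations on a countable set are countable in number, so a single null set serves
all of them, and hence all approximating sequences. -/
lemma ae_regular [Countable V] {Ω : Type*} [MeasurableSpace Ω] {μ : Measure Ω}
    [IsProbabilityMeasure μ] {p : V → V → ℝ} {Fp Fm : ℕ → ℝ} {X : Mark V → Ω → Set (ℝ × ℝ)}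
    (hX : ∀ m, IsPoissonPointProcess (X m)
      ((volume : Measure (ℝ × ℝ)).restrict (Set.Ioi 0 ×ˢ Set.Ioi 0)) μ)
    (hXind : iIndep (fun m => countSigma (X m)) μ) (hp : IsTransitionKernel p)
    (hF : IsReactionPair Fp Fm) : ∀ᵐ ω ∂μ, Regular p Fp Fm fun m => X m ω := by
  have hall : ∀ᵐ ω ∂μ, ∀ z : V →₀ ℕ, ∀ t, 0 ≤ t →
      ∃ ζ k, Evolves p Fp Fm (fun m => X m ω) 0 z t ζ k :=
    ae_all_iff.2 fun z => ae_exists_evolves hX hXind hp hF z.hasFiniteSupport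
  filter_upwards [hall, ae_mark_eq_of_mem hX hXind] with ω h1 h2
  exact ⟨fun z hz => h1 (Finsupp.ofSupportFinite z hz), h2⟩

/-- The restriction of a configuration to the first `n` sites. -/
noncomputable def truncate [Encodable V] (η : V → ℕ) (n : ℕ) : V → ℕ :=
  fun x => if Encodable.encode x < n then η x else 0

section Truncate

variable [Encodable V] (η : V → ℕ)

lemma finite_support_truncate (n : ℕ) : (Function.support (truncate η n)).Finite := by
  refine ((Set.finite_Iio n).preimage Encodable.encode_injective.injOn).subset fun x hx => ?_
  by_contra hlt
  exact hx (if_neg hlt)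

lemma truncate_mono : Monotone (truncate η) := by
  intro n k hnk x
  simp only [truncate]
  split_ifs <;> omega

lemma truncate_le (n : ℕ) : truncate η n ≤ η := by
  intro x
  simp only [truncate]
  split_ifs <;> omega

lemma eventually_truncate_eq (x : V) : ∀ᶠ n in atTop, truncate η n x = η x := by
  filter_upwards [eventually_gt_atTop (Encodable.encode x)] with n hn
  exact if_pos hn

end Truncate

/-- The limit of the flows started from the finite restrictions of a configuration. -/
noncomputable def limitFlow [Encodable V] (p : V → V → ℝ) (Fp Fm : ℕ → ℝ)
    (X : Mark V → Set (ℝ × ℝ)) (η : V → ℕ) (t : ℝ) : V → ℕ :=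
  fun x => ⨆ n, flow p Fp Fm X 0 t (truncate η n) x

section Limit

variable [Encodable V] {p : V → V → ℝ} {Fp Fm : ℕ → ℝ} {η : V → ℕ}

lemma Regular.monotone_flow_truncate {X : Mark V → Set (ℝ × ℝ)} (h : Regular p Fp Fm X)
    (hp : IsTransitionKernel p) {t : ℝ} (ht : 0 ≤ t) :
    Monotone fun n => flow p Fp Fm X 0 t (truncate η n) := fun n k hnk =>
  h.flow_mono hp (finite_support_truncate η n) (finite_support_truncate η k)
    (truncate_mono η hnk) ht

/-- Each `ηs n` lies below some truncation of `η`, and each truncation lies eventually below `ηs n`.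
Monotonicity of the flow squeezes the values at each site, and `limitFlow` itself is the dominating
configuration for the norm. -/
lemma Regular.tendsto_flow {X : Mark V → Set (ℝ × ℝ)} (h : Regular p Fp Fm X)
    (hp : IsTransitionKernel p) {α : V → ℝ} (hα : ∀ x, 0 < α x) {t : ℝ} (ht : 0 ≤ t)
    (hb : ∀ x, BddAbove (Set.range fun n => flow p Fp Fm X 0 t (truncate η n) x))
    (hfin : weight (alphaWeight α) (limitFlow p Fp Fm X η t) ≠ ∞)
    {ηs : ℕ → V → ℕ} (hmono : Monotone ηs) (hηs : ∀ n, ηs n ∈ finiteConf V)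
    (hlim : Tendsto (fun n => alphaNorm α (toRealConf (ηs n) - toRealConf η)) atTop (𝓝 0)) :
    Tendsto (fun n => alphaNorm α
      (toRealConf (flow p Fp Fm X 0 t (ηs n)) - toRealConf (limitFlow p Fp Fm X η t)))
      atTop (𝓝 0) := by
  have hev := eventually_eq_of_tendsto_alphaNorm hα hlim
  have hsupp := fun n => finite_support_of_mem_finiteConf (hηs n)
  have hle : ∀ n, ηs n ≤ η := fun n x => by
    obtain ⟨k, hk, hnk⟩ := ((hev x).and (eventually_ge_atTop n)).exists
    exact (hmono hnk x).trans hk.le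
  refine tendsto_alphaNorm_sub hα hfin (fun n => ?_) fun x => ?_
  · obtain ⟨k, hk⟩ := (eventually_le_of_eventually_eq (eventually_truncate_eq η) (hsupp n)
      (hle n)).exists
    exact (h.flow_mono hp (hsupp n) (finite_support_truncate η k) hk ht).trans
      fun x => le_ciSup (hb x) k
  · obtain ⟨k, hk⟩ := (eventually_eq_iSup (h.monotone_flow_truncate hp ht) (hb x)).exists
    filter_upwards [eventually_le_of_eventually_eq hev (finite_support_truncate η k)
      (truncate_le η k)] with n hn
    refine le_antisymm ?_ ?_
    · obtain ⟨j, hj⟩ := (eventually_le_of_eventually_eq (eventually_truncate_eq η) (hsupp n)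
        (hle n)).exists
      exact (h.flow_mono hp (hsupp n) (finite_support_truncate η j) hj ht x).trans
        (le_ciSup (hb x) j)
    · exact hk.ge.trans (h.flow_mono hp (finite_support_truncate η k) (hsupp n) hn ht x)

variable {Ω : Type*} [MeasurableSpace Ω] {μ : Measure Ω} [IsProbabilityMeasure μ]
  {X : Mark V → Ω → Set (ℝ × ℝ)}
  (hX : ∀ m, IsPoissonPointProcess (X m)
    ((volume : Measure (ℝ × ℝ)).restrict (Set.Ioi 0 ×ˢ Set.Ioi 0)) μ)
  (hXind : iIndep (fun m => countSigma (X m)) μ) (hp : IsTransitionKernel p)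
  (hF : IsReactionPair Fp Fm) {w : V → ℝ≥0∞} (hw : ∀ x, w x ≠ ∞) {c : ℝ} (hc : 0 ≤ c)
  (hpw : ∀ x, ∑' y, ENNReal.ofReal (p x y) * w y ≤ ENNReal.ofReal c * w x)

include hX hXind hp hF hw hc hpw

lemma measure_lt_iSup_flow_truncate_le {T : ℝ} (hT : 0 ≤ T) {A : ℝ≥0∞} (hA : A ≠ 0)
    (hA' : A ≠ ∞) :
    μ {ω | A < ⨆ n, ⨆ t ∈ Set.Icc 0 T,
        weight w (flow p Fp Fm (fun m => X m ω) 0 t (truncate η n))}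
      ≤ ENNReal.ofReal (Real.exp (c * T)) * weight w η / A := by
  -- Regularity is built into `U n` so that these events increase for every `ω`, as continuity from
  -- below requires.
  set U : ℕ → Set Ω := fun n => {ω | Regular p Fp Fm (fun m => X m ω) ∧
    A < ⨆ t ∈ Set.Icc 0 T, weight w (flow p Fp Fm (fun m => X m ω) 0 t (truncate η n))} with hU
  have hUmono : Monotone U := by
    rintro n k hnk ω ⟨hω, hlt⟩
    refine ⟨hω, hlt.trans_le (iSup₂_mono fun t ht => weight_mono w ?_)⟩
    exact hω.monotone_flow_truncate hp ht.1 hnk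
  calc _ ≤ μ (⋃ n, U n) := by
        refine measure_mono_ae ?_
        filter_upwards [ae_regular hX hXind hp hF] with ω hω hlt
        obtain ⟨n, hn⟩ := lt_iSup_iff.1 (show A < _ from hlt)
        exact Set.mem_iUnion.2 ⟨n, hω, hn⟩
    _ = ⨆ n, μ (U n) := hUmono.measure_iUnion
    _ ≤ _ := by
        refine iSup_le fun n => (measure_mono fun ω hω => hω.2).trans
          ((measure_lt_iSup_weight_flow_le hX hXind hp hF hw hc hpw (finite_support_truncate η n)
            hT hA hA').trans ?_)
        gcongr
        exact weight_mono w (truncate_le η n)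

lemma ae_iSup_flow_truncate_ne_top (hη : weight w η ≠ ∞) {T : ℝ} (hT : 0 ≤ T) :
    ∀ᵐ ω ∂μ, ⨆ n, ⨆ t ∈ Set.Icc 0 T,
      weight w (flow p Fp Fm (fun m => X m ω) 0 t (truncate η n)) ≠ ∞ := by
  rw [ae_iff]
  simp only [not_not]
  set E := ENNReal.ofReal (Real.exp (c * T)) * weight w η with hE
  have hlim : Tendsto (fun K : ℕ => E / ((K + 1 : ℕ) : ℝ≥0∞)) atTop (𝓝 0) := by
    have := (ENNReal.Tendsto.const_mul ENNReal.tendsto_inv_nat_nhds_zero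
      (.inr (ENNReal.mul_ne_top ENNReal.ofReal_ne_top hη : E ≠ ∞))).comp (tendsto_add_atTop_nat 1)
    rw [mul_zero] at this
    exact this
  refine le_antisymm (ge_of_tendsto' hlim fun K => ?_) zero_le
  refine (measure_mono fun ω hω => ?_).trans (measure_lt_iSup_flow_truncate_le (η := η) hX hXind
    hp hF hw hc hpw hT (A := ((K + 1 : ℕ) : ℝ≥0∞)) (by simp) (ENNReal.natCast_ne_top _))
  exact (ENNReal.natCast_lt_top (K + 1)).trans_eq (show _ = ∞ from hω).symm

/-- Finiteness of the supremum over integer time horizons gives one null set for all `t`, and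
monotone convergence identifies the weight of the limit. -/
lemma ae_bddAbove_flow_truncate (hw0 : ∀ x, w x ≠ 0) (hη : weight w η ≠ ∞) :
    ∀ᵐ ω ∂μ, ∀ t, 0 ≤ t →
      (∀ x, BddAbove (Set.range fun n => flow p Fp Fm (fun m => X m ω) 0 t (truncate η n) x)) ∧
      weight w (limitFlow p Fp Fm (fun m => X m ω) η t)
        = ⨆ n, weight w (flow p Fp Fm (fun m => X m ω) 0 t (truncate η n)) ∧
      weight w (limitFlow p Fp Fm (fun m => X m ω) η t) ≠ ∞ := by
  have hall : ∀ᵐ ω ∂μ, ∀ N : ℕ, ⨆ n, ⨆ t ∈ Set.Icc 0 (N : ℝ),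
      weight w (flow p Fp Fm (fun m => X m ω) 0 t (truncate η n)) ≠ ∞ :=
    ae_all_iff.2 fun N => ae_iSup_flow_truncate_ne_top hX hXind hp hF hw hc hpw hη N.cast_nonneg
  filter_upwards [hall, ae_regular hX hXind hp hF] with ω hω hreg t ht
  obtain ⟨N, hN⟩ := exists_nat_ge t
  have hle : ∀ n, weight w (flow p Fp Fm (fun m => X m ω) 0 t (truncate η n)) ≤
      ⨆ n, ⨆ t ∈ Set.Icc 0 (N : ℝ),
        weight w (flow p Fp Fm (fun m => X m ω) 0 t (truncate η n)) := fun n =>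
    le_iSup_of_le n (le_iSup₂_of_le (f := fun t (_ : t ∈ Set.Icc 0 (N : ℝ)) =>
      weight w (flow p Fp Fm (fun m => X m ω) 0 t (truncate η n))) t ⟨ht, hN⟩ le_rfl)
  have hb := bddAbove_of_weight_le hw0 (hω N) hle
  have heq := weight_iSup (w := w) (hreg.monotone_flow_truncate (η := η) hp ht) hb
  refine ⟨hb, heq, ?_⟩
  rw [show weight w (limitFlow p Fp Fm (fun m => X m ω) η t) = _ from heq]
  exact ne_top_of_le_ne_top (hω N) (iSup_le hle)

lemma aemeasurable_weight_limitFlow (hw0 : ∀ x, w x ≠ 0) (hη : weight w η ≠ ∞) {t : ℝ}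
    (ht : 0 ≤ t) :
    AEMeasurable (fun ω => weight w (limitFlow p Fp Fm (fun m => X m ω) η t)) μ ∧
      ∫⁻ ω, weight w (limitFlow p Fp Fm (fun m => X m ω) η t) ∂μ < ∞ := by
  have hflow := fun n => aemeasurable_and_lintegral_weight_flow_le hX hXind hp hF hw hc hpw
    (finite_support_truncate η n) ht
  have hae : (fun ω => ⨆ n, weight w (flow p Fp Fm (fun m => X m ω) 0 t (truncate η n)))
      =ᵐ[μ] fun ω => weight w (limitFlow p Fp Fm (fun m => X m ω) η t) := by
    filter_upwards [ae_bddAbove_flow_truncate hX hXind hp hF hw hc hpw hw0 hη] with ω hω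
    exact (hω t ht).2.1.symm
  refine ⟨(AEMeasurable.iSup fun n => (hflow n).1).congr hae, ?_⟩
  rw [← lintegral_congr_ae hae, lintegral_iSup' (fun n => (hflow n).1)]
  · refine (iSup_le fun n => (hflow n).2.trans ?_ :
      _ ≤ ENNReal.ofReal (Real.exp (c * t)) * weight w η).trans_lt
      (ENNReal.mul_lt_top ENNReal.ofReal_lt_top hη.lt_top)
    gcongr
    exact weight_mono w (truncate_le η n)
  · filter_upwards [ae_regular hX hXind hp hF] with ω hω
    exact fun n k hnk => weight_mono w (hω.monotone_flow_truncate hp ht hnk)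

/-- Suprema over time and over truncations commute, so the supremum over uncountably many times is
almost surely a countable supremum of measurable quantities. -/
lemma iSup_weight_limitFlow (hw0 : ∀ x, w x ≠ 0) (hη : weight w η ≠ ∞) {T : ℝ} :
    (fun ω => ⨆ n, ⨆ t ∈ Set.Icc 0 T,
        weight w (flow p Fp Fm (fun m => X m ω) 0 t (truncate η n)))
      =ᵐ[μ] fun ω => ⨆ t ∈ Set.Icc 0 T,
        weight w (limitFlow p Fp Fm (fun m => X m ω) η t) := by
  filter_upwards [ae_bddAbove_flow_truncate hX hXind hp hF hw hc hpw hw0 hη] with ω hω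
  rw [iSup_comm]
  refine iSup_congr fun t => ?_
  rw [iSup_comm]
  exact iSup_congr fun ht => (hω t ht.1).2.1.symm

end Limit

end Extension

end ReactionDiffusion

/-! ### The extension lemma. -/

open ReactionDiffusion in
theorem mainTheorem6 {V : Type*} [Countable V]
    (p : V → V → ℝ) (hp : IsTransitionKernel p)
    (α : V → ℝ) (hα : IsLocalization p α)
    (C : ℝ) (hC : 0 < C) (hpα : ∀ x, ∑' y, p x y * α y ≤ C * α x)
    (Fp Fm : ℕ → ℝ) (hF : IsReactionPair Fp Fm)
    {Ω : Type*} [MeasurableSpace Ω] (μ : Measure Ω) [IsProbabilityMeasure μ]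
    (X : Mark V → Ω → Set (ℝ × ℝ))
    (hX : ∀ m, IsPoissonPointProcess (X m)
      ((volume : Measure (ℝ × ℝ)).restrict (Set.Ioi 0 ×ˢ Set.Ioi 0)) μ)
    (hXind : iIndep (fun m => countSigma (X m)) μ)
    (η : V → ℕ) (hη : η ∈ alphaConf α) :
    ∃ Φη : ℝ → Ω → V → ℕ,
      (∀ᵐ ω ∂μ, ∀ t : ℝ, 0 ≤ t → Φη t ω ∈ alphaConf α) ∧
      (∀ᵐ ω ∂μ, ∀ ηs : ℕ → V → ℕ, Monotone ηs → (∀ n, ηs n ∈ finiteConf V) →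
        Tendsto (fun n => alphaNorm α (toRealConf (ηs n) - toRealConf η)) atTop (𝓝 0) →
        ∀ t : ℝ, 0 ≤ t →
          Tendsto (fun n => alphaNorm α
            (toRealConf (flow p Fp Fm (fun m => X m ω) 0 t (ηs n)) - toRealConf (Φη t ω)))
            atTop (𝓝 0)) ∧
      (∀ T A : ℝ, 0 ≤ T → 0 < A →
        NullMeasurableSet
          {ω | ENNReal.ofReal A < ⨆ t ∈ Set.Icc 0 T, alphaNorm α (toRealConf (Φη t ω))} μ ∧
        μ {ω | ENNReal.ofReal A < ⨆ t ∈ Set.Icc 0 T, alphaNorm α (toRealConf (Φη t ω))}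
          ≤ ENNReal.ofReal (Real.exp ((C + 1) * T)) * alphaNorm α (toRealConf η)
            / ENNReal.ofReal A) ∧
      (∀ t : ℝ, 0 ≤ t →
        AEMeasurable (fun ω => alphaNorm α (toRealConf (Φη t ω))) μ ∧
        ∫⁻ ω, alphaNorm α (toRealConf (Φη t ω)) ∂μ < ∞) := by
  -- An enumeration of the sites, along which `η` is truncated.
  have _ : Encodable V := Encodable.ofCountable V
  have hw : ∀ x, alphaWeight α x ≠ ∞ := fun x => ENNReal.ofReal_ne_top
  have hw0 : ∀ x, alphaWeight α x ≠ 0 := fun x => (ENNReal.ofReal_pos.2 (hα.pos x)).ne'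
  have hpw := tsum_ofReal_mul_alphaWeight_le hp hα hC hpα
  have hη' : weight (alphaWeight α) η ≠ ∞ := by
    rw [← alphaNorm_toRealConf hα.pos]
    exact ne_of_lt hη
  have hbdd := ae_bddAbove_flow_truncate hX hXind hp hF hw hC.le hpw hw0 hη'
  refine ⟨fun t ω => limitFlow p Fp Fm (fun m => X m ω) η t, ?_, ?_, fun T A hT hA => ?_,
    fun t ht => ?_⟩
  · filter_upwards [hbdd] with ω hω t ht
    change alphaNorm α _ < ∞
    rw [alphaNorm_toRealConf hα.pos]
    exact (hω t ht).2.2.lt_top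
  · filter_upwards [hbdd, ae_regular hX hXind hp hF] with ω hω hreg ηs hmono hηs hlim t ht
    exact hreg.tendsto_flow hp hα.pos ht (hω t ht).1 (hω t ht).2.2 hmono hηs hlim
  · simp only [alphaNorm_toRealConf hα.pos]
    have hae := iSup_weight_limitFlow (T := T) hX hXind hp hF hw hC.le hpw hw0 hη'
    have hAE : AEMeasurable (fun ω => ⨆ t ∈ Set.Icc 0 T,
        weight (alphaWeight α) (limitFlow p Fp Fm (fun m => X m ω) η t)) μ :=
      (AEMeasurable.iSup fun n => aemeasurable_iSup_weight_flow hX hXind hp hF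
        (finite_support_truncate η n) hT).congr hae
    refine ⟨nullMeasurableSet_lt aemeasurable_const hAE, ?_⟩
    refine (measure_mono_ae ?_).trans ((measure_lt_iSup_flow_truncate_le (η := η) hX hXind hp hF
      hw hC.le hpw hT (ENNReal.ofReal_pos.2 hA).ne' ENNReal.ofReal_ne_top).trans ?_)
    · filter_upwards [hae] with ω hω hlt
      exact (show ENNReal.ofReal A < _ from hlt).trans_eq hω.symm
    -- The argument gives the exponent `C * T`, which is relaxed to `(C + 1) * T`.
    · gcongr
      linarith
  · simp only [alphaNorm_toRealConf hα.pos]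
    exact aemeasurable_weight_limitFlow hX hXind hp hF hw hC.le hpw hw0 hη' ht
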